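/- \textbf{Setting.} Let $X$ be a Banach space admitting a $C^1$ Lipschitz bump function (a Lipschitz $C^1$ function $b:X\to\mathbb R$ with bounded non-empty support), and let $M$ be a connected, paracompact (Hausdorff) $C^1$ manifold modeled on $X$. Let $M$ carry a $C^1$ Finsler structure in the sense of Palais: a continuous map $\|\cdot\|_M:TM\to[0,\infty)$ whose restriction $\|\cdot\|_x$ to each $T_xM$ is a norm such that for every chart $\varphi:U\to X$: (P1) for each $x\in U$ the norm $v\mapsto\|d\varphi^{-1}(\varphi(x))(v)\|_x$ is equivalent to the norm of $X$; (P2) for each $x_0\in U$ and $\varepsilon>0$ there is an open neighborhood $W\subset U$ of $x_0$ such that $\frac1{1+\varepsilon}\|d\varphi^{-1}(\varphi(x_0))(v)\|_{x_0}\le\|d\varphi^{-1}(\varphi(x))(v)\|_x\le(1+\varepsilon)\|d\varphi^{-1}(\varphi(x_0))(v)\|_{x_0}$ for all $x\in W$, $v\in X$. Let $d(p,q)$ be the infimum of the lengths $\int_a^b\|c'(s)\|_{c(s)}\,ds$ of the piecewise $C^1$ paths $c:[a,b]\to M$ from $p$ to $q$, and assume that $M$ is complete for $d$. For $\Delta\in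 T_xM^*$ put $\|\Delta\|_x=\sup\{|\Delta(\xi)|:\xi\in T_xM,\ \|\xi\|_x=1\}$. Let $H:[0,\infty)\times M\times\mathbb R\to\mathbb R$ be continuous and satisfy condition (A): there are $C\ge0$ and a continuous $\omega:[0,\infty)\times\mathbb R\times\mathbb R\to\mathbb R$ with $\omega(0,0,0)=0$ such that for all $t_1,t_2\ge0$, $x_1,x_2\in M$, $r_1,r_2\in\mathbb R$, $$|H(t_1,x_1,r_1)-H(t_2,x_2,r_2)|\le\omega\big(|t_1-t_2|,d(x_1,x_2),r_1-r_2\big)+C\max\{|r_1|,|r_2|\}\big(|t_1-t_2|+d(x_1,x_2)\big).$$ Let $h:M\to\mathbb R$ be bounded and continuous, and consider $$u_t+H(t,x,\|u_x\|_x)=0\quad(t>0),\qquad u(0,x)=h(x).\tag{E}$$ For $f:[0,\infty)\times M\to\mathbb R$, $t>0$ and $x\in M$, let $D^+f(t,x)$ (respectively $D^-f(t,x)$) be the set of all $dg(t,x)=(\alpha,\Delta)\in\mathbb R\times T_xM^*$, where $g:(0,\infty)\times M\to\mathbb R$ is $C^1$ and $f-g$ has a local maximum (respectively minimum) at $(t,x)$.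 A function $u:[0,\infty)\times M\to\mathbb R$ is a viscosity subsolution of (E) if it is upper semicontinuous, $\alpha+H(t,x,\|\Delta\|_x)\le0$ for all $t>0$, $x\in M$, $(\alpha,\Delta)\in D^+u(t,x)$, and $u(0,x)\le h(x)$ for all $x\in M$. A function $v:[0,\infty)\times M\to\mathbb R$ is a viscosity supersolution of (E) if it is lower semicontinuous, $\alpha+H(t,x,\|\Delta\|_x)\ge0$ for all $t>0$, $x\in M$, $(\alpha,\Delta)\in D^-v(t,x)$, and $v(0,x)\ge h(x)$ for all $x\in M$. \textbf{Theorem.} Let $u$ be a viscosity subsolution and $v$ a viscosity supersolution of (E). Assume that $u$ and $v$ are bounded on $[0,T)\times M$ for every $T>0$, and that for every $(t,x)\in(0,\infty)\times M$ at least one of $u$, $v$ is Lipschitz in a neighborhood of $(t,x)$ (for the metric $|t-s|+d(x,y)$). Then $$\inf_{[0,\infty)\times M}(v-u)\ge0,$$ that is, $v\ge u$ on $[0,\infty)\times M$. -/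

import Mathlib

open Set Filter Topology
open scoped Manifold

noncomputable section

namespace FinslerHJ

/-- `X` admits a `C¹` Lipschitz bump function: a Lipschitz function of class `C¹` on `X` whose
support is bounded and non-empty. -/
def HasC1LipschitzBump (X : Type*) [NormedAddCommGroup X] [NormedSpace ℝ X] : Prop :=
  ∃ b : X → ℝ, ContDiff ℝ 1 b ∧ (∃ K : NNReal, LipschitzWith K b) ∧
    Bornology.IsBounded (tsupport b) ∧ (tsupport b).Nonempty

/-- The norm `v ↦ ‖d(φ⁻¹)(φ x) v‖ₓ` which a chart `φ` around `x` and a family `N` of (semi)norms on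
the tangent spaces induce on the model space. For `x` in the domain of `φ` the base point
`φ.symm (φ x)` is `x`. -/
def chartNorm {X : Type*} [NormedAddCommGroup X] [NormedSpace ℝ X]
    {M : Type*} [TopologicalSpace M] [ChartedSpace X M]
    (N : ∀ x : M, Seminorm ℝ (TangentSpace 𝓘(ℝ, X) x))
    (φ : OpenPartialHomeomorph M X) (x : M) (v : X) : ℝ :=
  N (φ.symm (φ x)) (mfderiv 𝓘(ℝ, X) 𝓘(ℝ, X) φ.symm (φ x) v)

/-- A `C¹` Finsler structure in the sense of Palais on a `C¹` manifold `M` modeled on `X`: a norm on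
each tangent space, continuous on the tangent bundle, which in every chart of the `C¹` manifold
(every member of the maximal atlas) satisfies the two conditions of Palais. -/
structure FinslerStructure (X : Type*) [NormedAddCommGroup X] [NormedSpace ℝ X]
    (M : Type*) [TopologicalSpace M] [ChartedSpace X M] [IsManifold 𝓘(ℝ, X) 1 M] where
  /-- The norm `‖·‖ₓ` on the tangent space at `x`. -/
  normAt : ∀ x : M, Seminorm ℝ (TangentSpace 𝓘(ℝ, X) x)
  /-- Each `‖·‖ₓ` is a norm, not just a seminorm. -/
  eq_zero_of_normAt : ∀ (x : M) (v : TangentSpace 𝓘(ℝ, X) x), normAt x v = 0 → v = 0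
  continuous_normAt : Continuous fun p : TangentBundle 𝓘(ℝ, X) M => normAt p.1 p.2
  /-- (P1): in every chart the norm `‖·‖ₓ` is equivalent to the norm of `X`. -/
  equivalent_norm : ∀ φ ∈ IsManifold.maximalAtlas 𝓘(ℝ, X) 1 M, ∀ x ∈ φ.source,
    ∃ K : ℝ, 1 ≤ K ∧ ∀ v : X,
      K⁻¹ * ‖v‖ ≤ chartNorm normAt φ x v ∧ chartNorm normAt φ x v ≤ K * ‖v‖
  /-- (P2): in every chart the norms at points close to `x₀` are `(1 + ε)`-equivalent to the norm
  at `x₀`. -/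
  palais : ∀ φ ∈ IsManifold.maximalAtlas 𝓘(ℝ, X) 1 M, ∀ x₀ ∈ φ.source, ∀ ε : ℝ, 0 < ε →
    ∃ W : Set M, IsOpen W ∧ x₀ ∈ W ∧ W ⊆ φ.source ∧ ∀ x ∈ W, ∀ v : X,
      (1 + ε)⁻¹ * chartNorm normAt φ x₀ v ≤ chartNorm normAt φ x v ∧
        chartNorm normAt φ x v ≤ (1 + ε) * chartNorm normAt φ x₀ v

/-- `c` is a piecewise `C¹` path on `[a, b]`: there is a partition `a = t₀ ≤ t₁ ≤ ⋯ ≤ tₙ = b` such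
that `c` is `C¹` on every `[tᵢ, tᵢ₊₁]` (this includes continuity on `[a, b]`). -/
def IsPiecewiseC1 (X : Type*) [NormedAddCommGroup X] [NormedSpace ℝ X]
    {M : Type*} [TopologicalSpace M] [ChartedSpace X M] (c : ℝ → M) (a b : ℝ) : Prop :=
  ∃ (n : ℕ) (t : ℕ → ℝ), Monotone t ∧ t 0 = a ∧ t n = b ∧
    ∀ i < n, ContMDiffOn 𝓘(ℝ, ℝ) 𝓘(ℝ, X) 1 c (Icc (t i) (t (i + 1)))

namespace FinslerStructure

variable {X : Type*} [NormedAddCommGroup X] [NormedSpace ℝ X]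
  {M : Type*} [TopologicalSpace M] [ChartedSpace X M] [IsManifold 𝓘(ℝ, X) 1 M]

/-- The length `∫ₐᵇ ‖c'(s)‖ ds` of a path. -/
def pathLength (F : FinslerStructure X M) (c : ℝ → M) (a b : ℝ) : ℝ :=
  ∫ s in a..b, F.normAt (c s) (mfderiv 𝓘(ℝ, ℝ) 𝓘(ℝ, X) c s (1 : ℝ))

/-- The Finsler metric: the infimum of the lengths of the piecewise `C¹` paths from `p` to `q`. -/
def dist (F : FinslerStructure X M) (p q : M) : ℝ :=
  sInf {l : ℝ | ∃ (c : ℝ → M) (a b : ℝ), a ≤ b ∧ IsPiecewiseC1 X c a b ∧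
    c a = p ∧ c b = q ∧ l = F.pathLength c a b}

/-- `M` is complete for the Finsler metric: every Cauchy sequence converges. -/
def IsComplete (F : FinslerStructure X M) : Prop :=
  ∀ s : ℕ → M, (∀ ε : ℝ, 0 < ε → ∃ n₀ : ℕ, ∀ m ≥ n₀, ∀ n ≥ n₀, F.dist (s m) (s n) < ε) →
    ∃ x : M, Tendsto (fun n => F.dist (s n) x) atTop (𝓝 0)

/-- The dual norm `‖Δ‖ₓ = sup {|Δ ξ| : ‖ξ‖ₓ = 1}` on the cotangent space at `x`. -/
def dualNorm (F : FinslerStructure X M) (x : M) (Δ : TangentSpace 𝓘(ℝ, X) x →L[ℝ] ℝ) : ℝ :=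
  sSup {r : ℝ | ∃ ξ : TangentSpace 𝓘(ℝ, X) x, F.normAt x ξ = 1 ∧ r = |Δ ξ|}

end FinslerStructure

section Differentials

variable {E : Type*} [NormedAddCommGroup E] [NormedSpace ℝ E] {G : Type*} [TopologicalSpace G]
  (I : ModelWithCorners ℝ E G) {N : Type*} [TopologicalSpace N] [ChartedSpace G N]

/-- The superdifferential `D⁺f(p)` of a function `f` on the open subset `Ω` of a manifold, at a
point `p` of `Ω`: all `dg(p)`, where `g` is `C¹` on `Ω` and `f - g` has a local maximum at `p`. -/
def superdifferential (Ω : Set N) (f : N → ℝ) (p : N) : Set (TangentSpace I p →L[ℝ] ℝ) :=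
  {Δ | ∃ g : N → ℝ, ContMDiffOn I 𝓘(ℝ, ℝ) 1 g Ω ∧ IsLocalMaxOn (fun q => f q - g q) Ω p ∧
    Δ = mfderiv I 𝓘(ℝ, ℝ) g p}

/-- The subdifferential `D⁻f(p)` of a function `f` on the open subset `Ω` of a manifold, at a
point `p` of `Ω`: all `dg(p)`, where `g` is `C¹` on `Ω` and `f - g` has a local minimum at `p`. -/
def subdifferential (Ω : Set N) (f : N → ℝ) (p : N) : Set (TangentSpace I p →L[ℝ] ℝ) :=
  {Δ | ∃ g : N → ℝ, ContMDiffOn I 𝓘(ℝ, ℝ) 1 g Ω ∧ IsLocalMinOn (fun q => f q - g q) Ω p ∧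
    Δ = mfderiv I 𝓘(ℝ, ℝ) g p}

end Differentials

section Evolution

variable {X : Type*} [NormedAddCommGroup X] [NormedSpace ℝ X]
  {M : Type*} [TopologicalSpace M] [ChartedSpace X M]

/-- The time component `α` of a covector `(α, Δ)` at the point `(t, x)` of `ℝ × M`: its value on the
unit tangent vector of the slice `ℝ × {x}`. -/
def timePart {t : ℝ} {x : M}
    (Λ : TangentSpace (𝓘(ℝ, ℝ).prod 𝓘(ℝ, X)) ((t, x) : ℝ × M) →L[ℝ] ℝ) : ℝ :=
  Λ (mfderiv 𝓘(ℝ, ℝ) (𝓘(ℝ, ℝ).prod 𝓘(ℝ, X)) (fun s : ℝ => ((s, x) : ℝ × M)) t (1 : ℝ))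

/-- The space component `Δ` of a covector `(α, Δ)` at the point `(t, x)` of `ℝ × M`: its restriction
to the tangent space of the slice `{t} × M`. -/
def spacePart {t : ℝ} {x : M}
    (Λ : TangentSpace (𝓘(ℝ, ℝ).prod 𝓘(ℝ, X)) ((t, x) : ℝ × M) →L[ℝ] ℝ) :
    TangentSpace 𝓘(ℝ, X) x →L[ℝ] ℝ :=
  Λ.comp (mfderiv 𝓘(ℝ, X) (𝓘(ℝ, ℝ).prod 𝓘(ℝ, X)) (fun y : M => ((t, y) : ℝ × M)) x)

variable [IsManifold 𝓘(ℝ, X) 1 M]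

/-- `u` (of which only the values on `[0, ∞) × M` matter) is a viscosity subsolution of
`u_t + H(t, x, ‖u_x‖ₓ) = 0` for `t > 0`, `u(0, ·) = h`. -/
def IsViscositySubsolution (F : FinslerStructure X M) (H : ℝ → M → ℝ → ℝ) (h : M → ℝ)
    (u : ℝ × M → ℝ) : Prop :=
  UpperSemicontinuousOn u (Ici 0 ×ˢ univ) ∧
  (∀ (t : ℝ) (x : M), 0 < t →
    ∀ Λ ∈ superdifferential (𝓘(ℝ, ℝ).prod 𝓘(ℝ, X)) (Ioi 0 ×ˢ univ) u (t, x),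
      timePart Λ + H t x (F.dualNorm x (spacePart Λ)) ≤ 0) ∧
  ∀ x : M, u (0, x) ≤ h x

/-- `u` (of which only the values on `[0, ∞) × M` matter) is a viscosity supersolution of
`u_t + H(t, x, ‖u_x‖ₓ) = 0` for `t > 0`, `u(0, ·) = h`. -/
def IsViscositySupersolution (F : FinslerStructure X M) (H : ℝ → M → ℝ → ℝ) (h : M → ℝ)
    (u : ℝ × M → ℝ) : Prop :=
  LowerSemicontinuousOn u (Ici 0 ×ˢ univ) ∧
  (∀ (t : ℝ) (x : M), 0 < t →
    ∀ Λ ∈ subdifferential (𝓘(ℝ, ℝ).prod 𝓘(ℝ, X)) (Ioi 0 ×ˢ univ) u (t, x),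
      0 ≤ timePart Λ + H t x (F.dualNorm x (spacePart Λ))) ∧
  ∀ x : M, h x ≤ u (0, x)

/-- Condition (A) for a Hamiltonian on `[0, ∞) × M × ℝ`. -/
def ConditionA (F : FinslerStructure X M) (H : ℝ → M → ℝ → ℝ) : Prop :=
  ∃ (C : ℝ) (ω : ℝ × ℝ × ℝ → ℝ), 0 ≤ C ∧ ContinuousOn ω (Ici 0 ×ˢ univ) ∧ ω (0, 0, 0) = 0 ∧
    ∀ (t₁ t₂ : ℝ), 0 ≤ t₁ → 0 ≤ t₂ → ∀ (x₁ x₂ : M) (r₁ r₂ : ℝ),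
      |H t₁ x₁ r₁ - H t₂ x₂ r₂| ≤ ω (|t₁ - t₂|, F.dist x₁ x₂, r₁ - r₂) +
        C * max |r₁| |r₂| * (|t₁ - t₂| + F.dist x₁ x₂)

/-- `u` is Lipschitz in a neighborhood of `p`, for the metric `|t - s| + d(x, y)` on `ℝ × M`. -/
def IsLipschitzNear (F : FinslerStructure X M) (u : ℝ × M → ℝ) (p : ℝ × M) : Prop :=
  ∃ L : ℝ, 0 ≤ L ∧ ∃ U ∈ 𝓝 p, ∀ q ∈ U, ∀ r ∈ U,
    |u q - u r| ≤ L * (|q.1 - r.1| + F.dist q.2 r.2)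

end Evolution

end FinslerHJ

end

namespace FinslerHJ

/-! Suppose `v - u = -δ < 0` at some `(t', x')`. Add an increasing exponential `θ` in time with
`θ(t') = δ/2` and `θ' ≥ m > 0` on `[0, ∞)`, so steep that `v - u + θ` is positive at time `t' + 1`;
it is positive at time `0` by the initial conditions, and at most `-δ/2` at `(t', x')`. Ekeland's
principle on the complete space `[0, t' + 1] × M` then gives an interior point where `v - u + θ`
plus `ε` times the distance is minimal.

Neither `u` nor `v` need be differentiable there. A fuzzy sum rule in a chart gives nearby points
carrying a subgradient of `v` and a supergradient of `u` whose time parts differ by `-θ'` and whose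
dual norms agree, both up to a multiple of `ε`. Subtracting the viscosity inequalities, `-θ' ≤ -m`
must be outweighed by the variation of `H`. Condition (A) makes that variation smaller: the local
Lipschitz bound on `u` or `v` bounds both gradients by an `L` independent of the distance `ρ`
between the points, so the term `C * L * ρ` can be made small.

The sum rule (`exists_isLocalMin_add`) comes from the Deville–Godefroy–Zizler principle
(`exists_smooth_perturbation`) on the threefold product of `ℝ × X`, and this is where the bump
function enters. Passing from chart to manifold rests on (P2), which makes the Finsler norms near
`x₀` almost constant (`exists_ball_dist_le`), and on extending test functions from a chart
(`exists_contMDiff_eq_chart`). Both are combined in `exists_close_differentials`. -/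

/-- `E` admits a `C¹` Lipschitz function with values in `[0, 1]`, equal to `1` at the origin and
vanishing outside a ball. -/
def HasNormalizedBump (E : Type*) [NormedAddCommGroup E] [NormedSpace ℝ E] : Prop :=
  ∃ (b : E → ℝ) (K R : ℝ), ContDiff ℝ 1 b ∧ 0 ≤ K ∧ (∀ x y, |b x - b y| ≤ K * ‖x - y‖) ∧
    (∀ x, 0 ≤ b x ∧ b x ≤ 1) ∧ b 0 = 1 ∧ 0 < R ∧ ∀ x, R ≤ ‖x‖ → b x = 0

/-! ### Normalized bump functions and the smooth variational principle. -/

section Bump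

variable {E : Type*} [NormedAddCommGroup E] [NormedSpace ℝ E]
  {E' : Type*} [NormedAddCommGroup E'] [NormedSpace ℝ E']

/-- Translate and rescale the bump so that its value at the origin is `π/2`, then apply `sin²`: this
is smooth and Lipschitz, has values in `[0, 1]`, sends `π/2` to `1` and keeps the zeros. -/
theorem HasC1LipschitzBump.hasNormalizedBump (h : HasC1LipschitzBump E) :
    HasNormalizedBump E := by
  obtain ⟨b, hb, ⟨K, hK⟩, hbdd, hne⟩ := h
  obtain ⟨x₀, hx₀⟩ : ∃ x₀, b x₀ ≠ 0 := by
    rw [tsupport, closure_nonempty_iff] at hne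
    exact hne
  obtain ⟨R, hR⟩ := hbdd.exists_norm_le
  set f : E → ℝ := fun x => Real.pi / 2 * (b (x + x₀) / b x₀) with hf
  have hcf : ContDiff ℝ 1 f := by
    have : ContDiff ℝ 1 fun x => b (x + x₀) := hb.comp (contDiff_id.add contDiff_const)
    exact contDiff_const.mul (this.div_const _)
  have hfK : ∀ x y, |f x - f y| ≤ Real.pi / 2 * (K / |b x₀|) * ‖x - y‖ := by
    intro x y
    have h1 : |b (x + x₀) - b (y + x₀)| ≤ K * ‖x - y‖ := by
      have := hK.dist_le_mul (x + x₀) (y + x₀)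
      simpa [dist_eq_norm] using this
    have h2 : f x - f y = Real.pi / 2 * ((b (x + x₀) - b (y + x₀)) / b x₀) := by
      simp only [hf]; ring
    rw [h2, abs_mul, abs_div (_ - _), abs_of_pos (show 0 < Real.pi / 2 by positivity)]
    calc _ ≤ Real.pi / 2 * (K * ‖x - y‖ / |b x₀|) := by gcongr
      _ = _ := by ring
  have hsin : ∀ s t : ℝ, |Real.sin s ^ 2 - Real.sin t ^ 2| ≤ 2 * |s - t| := by
    intro s t
    have h1 : |Real.sin s - Real.sin t| ≤ |s - t| := by
      have : LipschitzWith 1 Real.sin :=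
        lipschitzWith_of_nnnorm_deriv_le Real.differentiable_sin fun x => by
          rw [Real.deriv_sin, ← NNReal.coe_le_coe]
          simpa using Real.abs_cos_le_one x
      simpa [Real.dist_eq] using this.dist_le_mul s t
    have h2 : |Real.sin s + Real.sin t| ≤ 2 := by
      have := abs_add_le (Real.sin s) (Real.sin t)
      linarith [Real.abs_sin_le_one s, Real.abs_sin_le_one t]
    rw [sq_sub_sq, abs_mul]
    exact mul_le_mul h2 h1 (abs_nonneg _) zero_le_two
  refine ⟨fun x => Real.sin (f x) ^ 2, 2 * (Real.pi / 2 * (K / |b x₀|)), max 1 (R + ‖x₀‖ + 1),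
    (Real.contDiff_sin.comp hcf).pow 2, by positivity, fun x y => ?_,
    fun x => ⟨sq_nonneg _, Real.sin_sq_le_one _⟩, ?_, by positivity, fun x hx => ?_⟩
  · rw [mul_assoc]
    exact (hsin _ _).trans (by gcongr; exact hfK x y)
  · simp [hf, hx₀]
  · have : b (x + x₀) = 0 := by
      by_contra hne
      have h1 := hR _ (subset_tsupport b hne)
      have h2 : ‖x‖ ≤ ‖x + x₀‖ + ‖x₀‖ := by simpa using norm_sub_le (x + x₀) x₀
      linarith [(le_max_right _ _).trans hx]
    simp [hf, this]

theorem hasNormalizedBump_real : HasNormalizedBump ℝ := by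
  let b : ContDiffBump (0 : ℝ) := default
  have hc : ContDiff ℝ 1 b := b.contDiff
  refine HasC1LipschitzBump.hasNormalizedBump
    ⟨b, hc, hc.lipschitzWith_of_hasCompactSupport b.hasCompactSupport one_ne_zero,
      b.hasCompactSupport.isBounded, ?_⟩
  rw [b.tsupport_eq]
  exact Metric.nonempty_closedBall.2 b.rOut_pos.le

theorem HasNormalizedBump.prod (h : HasNormalizedBump E) (h' : HasNormalizedBump E') :
    HasNormalizedBump (E × E') := by
  obtain ⟨b, K, R, hb, hK, hbK, hb01, hb0, hR, hbR⟩ := h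
  obtain ⟨b', K', R', hb', hK', hbK', hb01', hb0', hR', hbR'⟩ := h'
  refine ⟨fun z => b z.1 * b' z.2, K + K', max R R',
    (hb.comp contDiff_fst).mul (hb'.comp contDiff_snd), by positivity, fun z w => ?_,
    fun z => ⟨mul_nonneg (hb01 _).1 (hb01' _).1, mul_le_one₀ (hb01 _).2 (hb01' _).1 (hb01' _).2⟩,
    by simp [hb0, hb0'], by positivity, fun z hz => ?_⟩
  · have h1 : b z.1 * b' z.2 - b w.1 * b' w.2 =
        (b z.1 - b w.1) * b' z.2 + b w.1 * (b' z.2 - b' w.2) := by ring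
    have h2 : |(b z.1 - b w.1) * b' z.2| ≤ K * ‖z - w‖ := by
      rw [abs_mul, abs_of_nonneg (hb01' _).1]
      refine (mul_le_of_le_one_right (abs_nonneg _) (hb01' _).2).trans ((hbK _ _).trans ?_)
      gcongr
      exact norm_fst_le (z - w)
    have h3 : |b w.1 * (b' z.2 - b' w.2)| ≤ K' * ‖z - w‖ := by
      rw [abs_mul, abs_of_nonneg (hb01 _).1]
      refine (mul_le_of_le_one_left (abs_nonneg _) (hb01 _).2).trans ((hbK' _ _).trans ?_)
      gcongr
      exact norm_snd_le (z - w)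
    rw [h1, add_mul]
    exact (abs_add_le _ _).trans (add_le_add h2 h3)
  · rcases le_max_iff.1 (show max R R' ≤ max ‖z.1‖ ‖z.2‖ from hz) with h | h
    · simp [hbR _ ((le_max_left _ _).trans h)]
    · simp [hbR' _ ((le_max_right _ _).trans h)]

/-- A smooth variational principle of Deville, Godefroy and Zizler. -/
theorem HasNormalizedBump.exists_smooth_perturbation [CompleteSpace E]
    (hE : HasNormalizedBump E) {S : Set E} (hS : IsClosed S) (hne : S.Nonempty) {f : E → ℝ}
    (hf : LowerSemicontinuousOn f S) {B : ℝ} (hB : ∀ x ∈ S, B ≤ f x) {ε : ℝ} (hε : 0 < ε) :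
    ∃ g : E → ℝ, ContDiff ℝ 1 g ∧ (∀ x, 0 ≤ g x ∧ g x ≤ ε) ∧ (∀ x, ‖fderiv ℝ g x‖ ≤ ε) ∧
      ∃ x ∈ S, ∀ y ∈ S, f x - g x ≤ f y - g y := by
  obtain ⟨b, K, R, hb, hK, hbK, hb01, hb0, hR, hbR⟩ := hE
  -- The perturbation will be `∑ e n * b (2 ^ n • (y - x n))` with `e n = a / 8 ^ n`. Its values sum
  -- to at most `8a/7` and its Lipschitz constants `a K / 4 ^ n` to `4aK/3`.
  obtain ⟨a, ha, ha1, haK⟩ : ∃ a : ℝ, 0 < a ∧ 2 * a ≤ ε ∧ 2 * a * K ≤ ε := by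
    refine ⟨ε / (2 * (1 + K)), by positivity, ?_, ?_⟩
    · rw [mul_div_assoc', div_le_iff₀ (by positivity)]; nlinarith [mul_nonneg hε.le hK]
    · rw [mul_div_assoc', div_mul_eq_mul_div, div_le_iff₀ (by positivity)]
      nlinarith [mul_nonneg hε.le hK]
  set e : ℕ → ℝ := fun n => a * (1 / 8) ^ n with he
  have he0 : ∀ n, 0 < e n := fun n => by positivity
  have hes : Summable e := (summable_geometric_of_lt_one (by norm_num) (by norm_num)).mul_left a
  have hchoose : ∀ (n : ℕ) (g : E → ℝ), (∃ C, ∀ y, g y ≤ C) →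
      ∃ x, x ∈ S ∧ ∀ y ∈ S, f x - g x ≤ f y - g y + e n / 2 := by
    rintro n g ⟨C, hC⟩
    have hbb : BddBelow ((fun y => f y - g y) '' S) :=
      ⟨B - C, by rintro _ ⟨y, hy, rfl⟩; linarith [hB y hy, hC y]⟩
    obtain ⟨_, ⟨x, hx, rfl⟩, hlt⟩ := Real.lt_sInf_add_pos (hne.image fun y => f y - g y)
      (half_pos (he0 n))
    exact ⟨x, hx, fun y hy => hlt.le.trans (by gcongr; exact csInf_le hbb ⟨y, hy, rfl⟩)⟩
  choose! X hXS hX using hchoose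
  let φ : ℕ → E → E → ℝ := fun n c y => e n * b ((2 : ℝ) ^ n • (y - c))
  have hφ0 : ∀ n c y, 0 ≤ φ n c y := fun n c y => mul_nonneg (he0 n).le (hb01 _).1
  have hφe : ∀ n c y, φ n c y ≤ e n := fun n c y =>
    mul_le_of_le_one_right (he0 n).le (hb01 _).2
  -- Each stage picks an almost minimizer of `f - G n` and lowers the function there by a new,
  -- narrower bump.
  let G : ℕ → E → ℝ := fun n => Nat.rec (fun _ => 0) (fun n g y => g y + φ n (X n g) y) n
  set x : ℕ → E := fun n => X n (G n) with hx
  have hG : ∀ n y, G (n + 1) y = G n y + φ n (x n) y := fun n y => rfl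
  have hGs : ∀ n y, G n y = ∑ i ∈ Finset.range n, φ i (x i) y := by
    intro n y
    induction n with
    | zero => rfl
    | succ n ih => rw [hG, ih, Finset.sum_range_succ]
  have hGb : ∀ n, ∃ C, ∀ y, G n y ≤ C := fun n =>
    ⟨∑ i ∈ Finset.range n, e i, fun y => by rw [hGs]; exact Finset.sum_le_sum fun i _ => hφe _ _ _⟩
  have hxS : ∀ n, x n ∈ S := fun n => hXS n _ (hGb n)
  have hxm : ∀ n, ∀ y ∈ S, f (x n) - G n (x n) ≤ f y - G n y + e n / 2 :=
    fun n => hX n _ (hGb n)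
  -- If `x (n + 1)` missed the `n`-th bump, the gain `e n` at `x n` would be at most the two errors
  -- `e n / 2 + e (n + 1) / 2 = 9 e n / 16`.
  have hstep : ∀ n, dist (x n) (x (n + 1)) ≤ R * (1 / 2) ^ n := by
    intro n
    by_contra! hlt
    have h1 := hxm (n + 1) (x n) (hxS n)
    have h2 := hxm n (x (n + 1)) (hxS _)
    have h3 : φ n (x n) (x n) = e n := by simp [φ, hb0]
    have h4 : φ n (x n) (x (n + 1)) = 0 := by
      simp only [φ]
      rw [hbR, mul_zero]
      rw [norm_smul, ← dist_eq_norm, dist_comm, norm_pow, Real.norm_ofNat]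
      calc R = 2 ^ n * (R * (1 / 2) ^ n) := by rw [one_div, inv_pow]; field_simp
        _ ≤ _ := by gcongr
    rw [hG, hG, h3, h4] at h1
    have h5 : e (n + 1) = e n / 8 := by simp only [he, pow_succ]; ring
    linarith [he0 n]
  obtain ⟨z, hz⟩ := cauchySeq_tendsto_of_complete
    (cauchySeq_of_le_geometric (1 / 2) R (by norm_num) hstep)
  have hzS : z ∈ S := hS.mem_of_tendsto hz (Eventually.of_forall hxS)
  have hsum : ∀ y, Summable fun n => φ n (x n) y := fun y =>
    Summable.of_nonneg_of_le (fun n => hφ0 _ _ _) (fun n => hφe _ _ _) hes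
  set g : E → ℝ := fun y => ∑' n, φ n (x n) y with hg
  have hlip : ∀ n c y y', |φ n c y - φ n c y'| ≤ a * K * (1 / 4) ^ n * ‖y - y'‖ := by
    intro n c y y'
    have h1 := hbK ((2 : ℝ) ^ n • (y - c)) ((2 : ℝ) ^ n • (y' - c))
    rw [← smul_sub, sub_sub_sub_cancel_right, norm_smul, norm_pow, Real.norm_ofNat] at h1
    simp only [φ]
    rw [← mul_sub, abs_mul, abs_of_pos (he0 n)]
    calc _ ≤ e n * (K * (2 ^ n * ‖y - y'‖)) := by gcongr
      _ = _ := by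
        simp only [he]
        rw [show (1 / 4 : ℝ) = 1 / 8 * 2 by norm_num, mul_pow]; ring
  have hφc : ∀ n c, ContDiff ℝ 1 (φ n c) := fun n c =>
    contDiff_const.mul (hb.comp ((contDiff_id.sub contDiff_const).const_smul _))
  have hs4 : Summable fun n : ℕ => a * K * (1 / 4 : ℝ) ^ n :=
    (summable_geometric_of_lt_one (by norm_num) (by norm_num)).mul_left _
  have hdφ : ∀ n c y, ‖fderiv ℝ (φ n c) y‖ ≤ a * K * (1 / 4) ^ n := by
    intro n c y
    have : LipschitzWith (Real.toNNReal (a * K * (1 / 4) ^ n)) (φ n c) :=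
      LipschitzWith.of_dist_le_mul fun y y' => by
        rw [Real.coe_toNNReal _ (by positivity), Real.dist_eq, dist_eq_norm]
        exact hlip n c y y'
    have h2 := norm_fderiv_le_of_lipschitz ℝ (x₀ := y) this
    rwa [Real.coe_toNNReal _ (by positivity)] at h2
  have hgc : ContDiff ℝ 1 g := by
    refine contDiff_tsum (v := fun k n => if k = 0 then e n else a * K * (1 / 4) ^ n)
      (fun n => hφc n _) (fun k _ => ?_) (fun k n y hk => ?_)
    · by_cases hk : k = 0
      · simpa [hk] using hes
      · simpa [hk] using hs4
    · have hk' : k = 0 ∨ k = 1 := by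
        have : k ≤ 1 := by exact_mod_cast hk
        omega
      rcases hk' with rfl | rfl
      · simpa [abs_of_nonneg (hφ0 n (x n) y)] using hφe n (x n) y
      · simpa [norm_iteratedFDeriv_one] using hdφ n (x n) y
  have hGg : ∀ n y, G n y ≤ g y := fun n y => by
    rw [hGs]; exact (hsum y).sum_le_tsum _ fun i _ => hφ0 _ _ _
  have hgG : ∀ n y, g y ≤ G n y + 2 * e n := by
    intro n y
    simp only [hGs, hg]
    rw [← (hsum y).sum_add_tsum_nat_add n]
    gcongr
    have hes' : Summable fun m => e (m + n) := (summable_nat_add_iff n).2 hes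
    refine (((summable_nat_add_iff n).2 (hsum y)).tsum_le_tsum (fun m => hφe _ _ _) hes').trans ?_
    have : ∀ m, e (m + n) = e n * (1 / 8) ^ m := fun m => by simp only [he, pow_add]; ring
    simp_rw [this]
    rw [tsum_mul_left, tsum_geometric_of_lt_one (by norm_num) (by norm_num)]
    have := he0 n
    norm_num
    linarith
  refine ⟨g, hgc, fun y => ⟨?_, ?_⟩, fun y => ?_, z, hzS, fun y hy => ?_⟩
  · exact tsum_nonneg fun n => hφ0 _ _ _
  · have := hgG 0 y
    rw [hGs] at this
    simp only [Finset.range_zero, Finset.sum_empty, he, pow_zero, mul_one, zero_add] at this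
    linarith
  · have hL : LipschitzWith (Real.toNNReal ε) g := by
      refine LipschitzWith.of_dist_le_mul fun y y' => ?_
      rw [Real.coe_toNNReal _ hε.le, Real.dist_eq, dist_eq_norm, hg]
      simp only
      rw [← (hsum y).tsum_sub (hsum y'), ← Real.norm_eq_abs]
      refine (tsum_of_norm_bounded (hs4.mul_right ‖y - y'‖).hasSum
        fun n => hlip n (x n) y y').trans ?_
      rw [tsum_mul_right, tsum_mul_left, tsum_geometric_of_lt_one (by norm_num) (by norm_num)]
      gcongr
      have : 0 ≤ a * K := by positivity
      norm_num
      linarith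
    have h2 := norm_fderiv_le_of_lipschitz ℝ (x₀ := y) hL
    rwa [Real.coe_toNNReal _ hε.le] at h2
  · by_contra! hlt
    set δ := (f z - g z - (f y - g y)) / 4 with hδ
    have hδ0 : 0 < δ := by rw [hδ]; linarith
    -- Lower semicontinuity carries the almost minimality of `x n` for `f - G n` over to `z` and `f
    -- - g`, the tail of the series being at most `2 * e n`.
    have hz' : Tendsto x atTop (𝓝[S] z) :=
      tendsto_nhdsWithin_iff.2 ⟨hz, Eventually.of_forall hxS⟩
    have h1 : ∀ᶠ n in atTop, f z - δ < f (x n) := hz'.eventually (hf z hzS _ (by linarith))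
    have h2 : ∀ᶠ n in atTop, g (x n) < g z + δ :=
      (hgc.continuous.continuousAt.tendsto.comp hz).eventually_lt_const (by linarith)
    have h3 : ∀ᶠ n in atTop, e n < δ / 3 :=
      hes.tendsto_atTop_zero.eventually_lt_const (by positivity)
    obtain ⟨n, h1, h2, h3⟩ := (h1.and (h2.and h3)).exists
    have h4 := hxm n y hy
    have h5 := hGg n (x n)
    have h6 := hgG n y
    have := he0 n
    linarith

end Bump

/-! ### Ekeland's variational principle. -/

/-- Ekeland's variational principle for a distance function. -/
theorem exists_ekeland_point {α : Type*} {d : α → α → ℝ} (d_nonneg : ∀ x y, 0 ≤ d x y)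
    (d_self : ∀ x, d x x = 0) (d_comm : ∀ x y, d x y = d y x)
    (d_triangle : ∀ x y z, d x z ≤ d x y + d y z) {f : α → ℝ} {B : ℝ} (hB : ∀ x, B ≤ f x)
    (hd : ∀ s : ℕ → α, (∀ ε : ℝ, 0 < ε → ∃ N, ∀ m ≥ N, ∀ n ≥ N, d (s m) (s n) < ε) →
      ∃ x, Tendsto (fun n => d (s n) x) atTop (𝓝 0) ∧
        ∀ c, (∀ᶠ n in atTop, f (s n) ≤ c) → f x ≤ c)
    (a : α) {ε : ℝ} (hε : 0 < ε) :
    ∃ z, f z ≤ f a ∧ ∀ y, f z ≤ f y + ε * d y z := by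
  -- The next point almost minimizes `f` among the points that improve on `w` by at least `ε` times
  -- their distance to it.
  have hchoose : ∀ (n : ℕ) (w : α), ∃ z, f z + ε * d z w ≤ f w ∧
      ∀ y, f y + ε * d y w ≤ f w → f z ≤ f y + (1 / 2) ^ n := by
    intro n w
    have hbb : BddBelow (f '' {y | f y + ε * d y w ≤ f w}) :=
      ⟨B, by rintro _ ⟨y, -, rfl⟩; exact hB y⟩
    have hw : w ∈ {y | f y + ε * d y w ≤ f w} := by simp [d_self]
    obtain ⟨_, ⟨z, hz, rfl⟩, hlt⟩ := Real.lt_sInf_add_pos (⟨f w, w, hw, rfl⟩ :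
      (f '' {y | f y + ε * d y w ≤ f w}).Nonempty) (show (0 : ℝ) < (1 / 2) ^ n by positivity)
    exact ⟨z, hz, fun y hy => hlt.le.trans (by gcongr; exact csInf_le hbb ⟨y, hy, rfl⟩)⟩
  choose X hX1 hX2 using hchoose
  let s : ℕ → α := fun n => Nat.rec a (fun n w => X n w) n
  have hs : ∀ n, s (n + 1) = X n (s n) := fun n => rfl
  have hmono : ∀ m n, m ≤ n → f (s n) + ε * d (s n) (s m) ≤ f (s m) := by
    intro m n hmn
    induction n, hmn using Nat.le_induction with
    | base => simp [d_self]
    | succ n hn ih =>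
      have h1 := hX1 n (s n)
      rw [← hs] at h1
      nlinarith [d_triangle (s (n + 1)) (s n) (s m)]
  have hanti : Antitone fun n => f (s n) := fun m n hmn => by
    have := hmono m n hmn
    have := mul_nonneg hε.le (d_nonneg (s n) (s m))
    simp only
    linarith
  have hlim := tendsto_atTop_ciInf hanti ⟨B, by rintro _ ⟨n, rfl⟩; exact hB _⟩
  set ℓ := ⨅ n, f (s n)
  have hℓ : ∀ n, ℓ ≤ f (s n) := fun n => ciInf_le ⟨B, by rintro _ ⟨n, rfl⟩; exact hB _⟩ n
  obtain ⟨z, hz, hfz⟩ := hd s fun δ hδ => by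
    obtain ⟨N, hN⟩ := (hlim.eventually_lt_const
      (show ℓ < ℓ + ε * (δ / 2) by linarith [mul_pos hε (half_pos hδ)])).exists
    have key : ∀ n ≥ N, d (s n) (s N) < δ / 2 := fun n hn => by
      have := hmono N n hn
      have := hℓ n
      exact lt_of_mul_lt_mul_left (by linarith) hε.le
    refine ⟨N, fun m hm n hn => ?_⟩
    have := d_triangle (s m) (s N) (s n)
    rw [d_comm (s N)] at this
    linarith [key m hm, key n hn]
  have hzs : ∀ n, f z + ε * d z (s n) ≤ f (s n) := by
    intro n
    refine le_of_forall_pos_le_add fun δ hδ => ?_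
    have h1 : ∀ᶠ m in atTop, d (s m) z < δ / ε := hz.eventually_lt_const (by positivity)
    have h2 := hfz (f (s n) - ε * d z (s n) + δ) <| by
      filter_upwards [h1, eventually_ge_atTop n] with m hm hmn
      have h3 := hmono n m hmn
      have h4 := d_triangle z (s m) (s n)
      rw [d_comm z (s m)] at h4
      rw [lt_div_iff₀ hε] at hm
      nlinarith
    linarith
  have hdz : ∀ n, 0 ≤ ε * d z (s n) := fun n => mul_nonneg hε.le (d_nonneg _ _)
  refine ⟨z, show f z ≤ f (s 0) by linarith [hzs 0, hdz 0], fun y => ?_⟩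
  by_contra! hlt
  -- A point `y` violating the claim improves on `z`, hence on every `s n`; so it competed in each
  -- choice, which forces `f z ≤ f y`.
  have h1 : ∀ n, f z ≤ f y + (1 / 2) ^ n := fun n => by
    refine le_trans ?_ (hX2 n (s n) y ?_)
    · rw [← hs]; linarith [hzs (n + 1), hdz (n + 1)]
    · nlinarith [hzs n, d_triangle y z (s n)]
  have h2 : f z ≤ f y := by
    have h3 : Tendsto (fun n : ℕ => f y + (1 / 2 : ℝ) ^ n) atTop (𝓝 (f y + 0)) :=
      tendsto_const_nhds.add (tendsto_pow_atTop_nhds_zero_of_lt_one (by norm_num) (by norm_num))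
    rw [add_zero] at h3
    exact ge_of_tendsto' h3 h1
  linarith [mul_nonneg hε.le (d_nonneg y z)]

/-! ### Fuzzy sum rule for three functions. -/

section Sum

variable {E : Type*} [NormedAddCommGroup E] [NormedSpace ℝ E]

/-- At a local minimum of the sum of a differentiable function and a function which is Lipschitz
in a direction, the derivative in this direction is bounded. -/
theorem abs_fderiv_le_of_isLocalMin_add {f g : E → ℝ} {z w : E} {c : ℝ}
    (hg : DifferentiableAt ℝ g z) (hmin : IsLocalMin (fun x => f x + g x) z)
    (hf : ∀ᶠ x in 𝓝 z, ∀ s : ℝ, x = z + s • w → f x - f z ≤ |s| * c) :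
    |fderiv ℝ g z w| ≤ c := by
  have key : ∀ σ : ℝ, |σ| = 1 → -(σ * fderiv ℝ g z w) ≤ c := by
    intro σ hσ
    have hline : HasDerivAt (fun s : ℝ => g (z + s • (σ • w))) (σ * fderiv ℝ g z w) 0 := by
      have h1 : HasDerivAt (fun s : ℝ => z + s • (σ • w)) (σ • w) 0 := by
        simpa using ((hasDerivAt_id (0 : ℝ)).smul_const (σ • w)).const_add z
      have h2 : HasFDerivAt g (fderiv ℝ g z) (z + (0 : ℝ) • (σ • w)) := by
        simpa using hg.hasFDerivAt
      simpa [Function.comp_def] using h2.comp_hasDerivAt (0 : ℝ) h1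
    have hlim := hline.tendsto_slope_zero_right
    have hcont : Tendsto (fun s : ℝ => z + s • (σ • w)) (𝓝[>] 0) (𝓝 z) := by
      have : Continuous fun s : ℝ => z + s • (σ • w) := by fun_prop
      have h2 := this.tendsto 0
      simp only [zero_smul, add_zero] at h2
      exact h2.mono_left nhdsWithin_le_nhds
    have hev : ∀ᶠ s : ℝ in 𝓝[>] 0,
        -c ≤ s⁻¹ • (g (z + (0 + s) • (σ • w)) - g (z + (0 : ℝ) • (σ • w))) := by
      filter_upwards [hcont.eventually hmin, hcont.eventually hf, self_mem_nhdsWithin]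
        with s h1 h2 h3
      have hs : 0 < s := h3
      have h4 := h2 (s * σ) (by rw [smul_smul])
      rw [abs_mul, hσ, mul_one, abs_of_pos hs] at h4
      simp only [zero_add, zero_smul, add_zero, smul_eq_mul]
      rw [inv_mul_eq_div, le_div_iff₀ hs]
      linarith
    linarith [ge_of_tendsto hlim hev]
  rw [abs_le]
  constructor
  · linarith [key 1 (by simp)]
  · linarith [key (-1) (by simp)]

/-- A fuzzy sum rule for three functions, at a strong local minimum of the sum. -/
theorem HasNormalizedBump.exists_isLocalMin_add_aux [CompleteSpace E]
    (hE : HasNormalizedBump E) {z₀ : E} {r : ℝ} (hr : 0 < r) {f₁ f₂ f₃ : E → ℝ}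
    (hf₁ : LowerSemicontinuousOn f₁ (Metric.closedBall z₀ r))
    (hf₂ : LowerSemicontinuousOn f₂ (Metric.closedBall z₀ r))
    (hf₃ : LowerSemicontinuousOn f₃ (Metric.closedBall z₀ r))
    {B : ℝ} (hB : ∀ z ∈ Metric.closedBall z₀ r, B ≤ f₁ z ∧ B ≤ f₂ z ∧ B ≤ f₃ z)
    {L : ℝ} (hL : 0 ≤ L)
    (hL₂ : ∀ z ∈ Metric.closedBall z₀ r, ∀ w ∈ Metric.closedBall z₀ r,
      f₂ z - f₂ w ≤ L * ‖z - w‖)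
    (hL₃ : ∀ z ∈ Metric.closedBall z₀ r, ∀ w ∈ Metric.closedBall z₀ r,
      f₃ z - f₃ w ≤ L * ‖z - w‖)
    {c : ℝ} (hc : 0 < c)
    (hmin : ∀ z ∈ Metric.closedBall z₀ r,
      f₁ z₀ + f₂ z₀ + f₃ z₀ + c * ‖z - z₀‖ ≤ f₁ z + f₂ z + f₃ z)
    {ρ : ℝ} (hρ : 0 < ρ) :
    ∃ (z₁ z₂ z₃ : E) (g₁ g₂ g₃ : E → ℝ), ‖z₁ - z₀‖ < ρ ∧ ‖z₂ - z₀‖ < ρ ∧ ‖z₃ - z₀‖ < ρ ∧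
      ContDiff ℝ 1 g₁ ∧ ContDiff ℝ 1 g₂ ∧ ContDiff ℝ 1 g₃ ∧
      IsLocalMin (fun z => f₁ z + g₁ z) z₁ ∧ IsLocalMin (fun z => f₂ z + g₂ z) z₂ ∧
      IsLocalMin (fun z => f₃ z + g₃ z) z₃ ∧
      ‖fderiv ℝ g₁ z₁ + fderiv ℝ g₂ z₂ + fderiv ℝ g₃ z₃‖ ≤ ρ := by
  -- With `ρ ≤ r` the points found are interior to the ball, so minima over the ball are local
  -- minima.
  wlog hρr : ρ ≤ r generalizing ρ with hwlog
  · obtain ⟨z₁, z₂, z₃, g₁, g₂, g₃, h1, h2, h3, h4⟩ := hwlog hr le_rfl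
    have := (not_le.1 hρr).le
    exact ⟨z₁, z₂, z₃, g₁, g₂, g₃, h1.trans_le this, h2.trans_le this, h3.trans_le this,
      h4.1, h4.2.1, h4.2.2.1, h4.2.2.2.1, h4.2.2.2.2.1, h4.2.2.2.2.2.1, h4.2.2.2.2.2.2.trans this⟩
  set S := Metric.closedBall z₀ r with hS
  have hz₀S : z₀ ∈ S := Metric.mem_closedBall_self hr.le
  have hE3 := hE.prod (hE.prod hE)
  obtain ⟨b, K, R, hb, hK, hbK, hb01, hb0, hR, hbR⟩ := hE
  set s₀ := f₁ z₀ + f₂ z₀ + f₃ z₀ with hs₀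
  have hBs : 3 * B ≤ s₀ := by linarith [hB z₀ hz₀S]
  -- Height of the penalty: a single `P` equal to `A` would push the decoupled sum above `s₀ + 1 ≥
  -- s₀ + e`.
  set A := s₀ - 3 * B + 2 with hA
  have hA0 : 0 < A := by linarith
  set e := min 1 (min ρ (c * ρ / 4)) with he
  have he0 : 0 < e := by positivity
  have he1 : e ≤ 1 := min_le_left _ _
  have heρ : e ≤ ρ := (min_le_right _ _).trans (min_le_left _ _)
  have hec : e ≤ c * ρ / 4 := (min_le_right _ _).trans (min_le_right _ _)
  set δ := min (ρ / 2) (c * ρ / (16 * (L + 1))) with hδ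
  have hδ0 : 0 < δ := by positivity
  have hδρ : δ ≤ ρ / 2 := min_le_left _ _
  have hδL : 2 * L * δ ≤ c * ρ / 8 := by
    have h1 : δ ≤ c * ρ / (16 * (L + 1)) := min_le_right _ _
    rw [le_div_iff₀ (by positivity)] at h1
    nlinarith
  set k := R / δ with hk
  have hk0 : 0 < k := by positivity
  let P : E → ℝ := fun z => A * (1 - b (k • z))
  have hPc : ContDiff ℝ 1 P :=
    contDiff_const.mul (contDiff_const.sub (hb.comp (contDiff_id.const_smul k)))
  have hP0 : ∀ z, 0 ≤ P z := fun z => mul_nonneg hA0.le (by linarith [(hb01 (k • z)).2])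
  have hPz : P 0 = 0 := by simp [P, hb0]
  have hPfar : ∀ z, δ ≤ ‖z‖ → P z = A := by
    intro z hz
    have : R ≤ ‖k • z‖ := by
      rw [norm_smul, Real.norm_eq_abs, abs_of_pos hk0, hk, div_mul_eq_mul_div,
        le_div_iff₀ hδ0]
      gcongr
    simp [P, hbR _ this]
  -- The three functions get independent variables, tied together by smooth penalties that force the
  -- variables within `δ` of each other.
  let Φ : E × E × E → ℝ := fun z =>
    f₁ z.1 + (f₂ z.2.1 + (f₃ z.2.2 + (P (z.2.1 - z.1) + P (z.2.2 - z.1))))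
  have hlsc : LowerSemicontinuousOn Φ (S ×ˢ S ×ˢ S) := by
    have h1 : LowerSemicontinuousOn (fun z : E × E × E => f₁ z.1) (S ×ˢ S ×ˢ S) :=
      hf₁.comp continuous_fst.continuousOn fun z hz => hz.1
    have h2 : LowerSemicontinuousOn (fun z : E × E × E => f₂ z.2.1) (S ×ˢ S ×ˢ S) :=
      hf₂.comp (continuous_fst.comp continuous_snd).continuousOn fun z hz => hz.2.1
    have h3 : LowerSemicontinuousOn (fun z : E × E × E => f₃ z.2.2) (S ×ˢ S ×ˢ S) :=
      hf₃.comp (continuous_snd.comp continuous_snd).continuousOn fun z hz => hz.2.2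
    have h4 : LowerSemicontinuousOn
        (fun z : E × E × E => P (z.2.1 - z.1) + P (z.2.2 - z.1)) (S ×ˢ S ×ˢ S) := by
      have := hPc.continuous
      exact (Continuous.continuousOn (by fun_prop)).lowerSemicontinuousOn
    exact h1.add (h2.add (h3.add h4))
  have hSc : IsClosed S := Metric.isClosed_closedBall
  obtain ⟨g, hgc, hg0, hgd, ⟨z₁, z₂, z₃⟩, ⟨hz₁, hz₂, hz₃⟩, hgmin⟩ :=
    hE3.exists_smooth_perturbation (hSc.prod (hSc.prod hSc)) ⟨(z₀, z₀, z₀), hz₀S, hz₀S, hz₀S⟩ hlsc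
      (B := 3 * B) (fun z hz => by
        have h1 := (hB _ hz.1).1
        have h2 := (hB _ hz.2.1).2.1
        have h3 := (hB _ hz.2.2).2.2
        have h4 := hP0 (z.2.1 - z.1)
        have h5 := hP0 (z.2.2 - z.1)
        simp only [Φ]
        linarith) he0
  simp only at hz₁ hz₂ hz₃
  have hΦ : Φ (z₁, z₂, z₃) ≤ s₀ + e := by
    have h1 := hgmin (z₀, z₀, z₀) ⟨hz₀S, hz₀S, hz₀S⟩
    have h2 : Φ (z₀, z₀, z₀) = s₀ := by simp only [Φ, sub_self, hPz, hs₀]; ring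
    linarith [(hg0 (z₁, z₂, z₃)).2, (hg0 (z₀, z₀, z₀)).1]
  simp only [Φ] at hΦ
  have hp2 := hP0 (z₂ - z₁)
  have hp3 := hP0 (z₃ - z₁)
  have hb1 := (hB _ hz₁).1
  have hb2 := (hB _ hz₂).2.1
  have hb3 := (hB _ hz₃).2.2
  have h12 : ‖z₂ - z₁‖ < δ := by
    by_contra! h
    have := hPfar _ h
    linarith
  have h13 : ‖z₃ - z₁‖ < δ := by
    by_contra! h
    have := hPfar _ h
    linarith
  -- Moving `z₂` and `z₃` to `z₁` costs at most `2 * L * δ`, so the strong minimum gives `c * ‖z₁ -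
  -- z₀‖ ≤ e + 2 * L * δ ≤ 3 * c * ρ / 8`. Only `f₂` and `f₃` need be Lipschitz.
  have hz₁ρ : ‖z₁ - z₀‖ < ρ / 2 := by
    have h1 := hmin z₁ hz₁
    have h2 := hL₂ z₁ hz₁ z₂ hz₂
    have h3 := hL₃ z₁ hz₁ z₃ hz₃
    rw [norm_sub_rev] at h2 h3
    have h4 : L * ‖z₂ - z₁‖ ≤ L * δ := by gcongr
    have h5 : L * ‖z₃ - z₁‖ ≤ L * δ := by gcongr
    have h6 : c * ‖z₁ - z₀‖ < c * (ρ / 2) := by nlinarith [mul_pos hc hρ]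
    exact lt_of_mul_lt_mul_left h6 hc.le
  have hz₂ρ : ‖z₂ - z₀‖ < ρ := by
    have := norm_add_le (z₂ - z₁) (z₁ - z₀)
    rw [sub_add_sub_cancel] at this
    linarith
  have hz₃ρ : ‖z₃ - z₀‖ < ρ := by
    have := norm_add_le (z₃ - z₁) (z₁ - z₀)
    rw [sub_add_sub_cancel] at this
    linarith
  have hnhds : ∀ z, ‖z - z₀‖ < ρ → S ∈ 𝓝 z := fun z hz =>
    mem_of_superset (Metric.isOpen_ball.mem_nhds
      (show z ∈ Metric.ball z₀ r by rw [mem_ball_iff_norm]; linarith)) Metric.ball_subset_closedBall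
  -- Freezing two of the three variables gives the test functions. In the sum of the derivatives the
  -- penalties cancel, leaving minus the derivative of `g` on the diagonal.
  refine ⟨z₁, z₂, z₃, fun z => P (z₂ - z) + P (z₃ - z) - g (z, z₂, z₃),
    fun z => P (z - z₁) - g (z₁, z, z₃), fun z => P (z - z₁) - g (z₁, z₂, z), by linarith, hz₂ρ,
    hz₃ρ, by fun_prop, by fun_prop, by fun_prop, ?_, ?_, ?_, ?_⟩
  · filter_upwards [hnhds z₁ (by linarith)] with z hz
    have := hgmin (z, z₂, z₃) ⟨hz, hz₂, hz₃⟩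
    simp only [Φ] at this
    linarith
  · filter_upwards [hnhds z₂ hz₂ρ] with z hz
    have := hgmin (z₁, z, z₃) ⟨hz₁, hz, hz₃⟩
    simp only [Φ] at this
    linarith
  · filter_upwards [hnhds z₃ hz₃ρ] with z hz
    have := hgmin (z₁, z₂, z) ⟨hz₁, hz₂, hz⟩
    simp only [Φ] at this
    linarith
  · have hPd : ∀ z, HasFDerivAt P (fderiv ℝ P z) z := fun z =>
      (hPc.differentiable one_ne_zero z).hasFDerivAt
    have hgd' : HasFDerivAt g (fderiv ℝ g (z₁, z₂, z₃)) (z₁, z₂, z₃) :=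
      (hgc.differentiable one_ne_zero _).hasFDerivAt
    set D := fderiv ℝ g (z₁, z₂, z₃) with hD
    have hid : ∀ z : E, HasFDerivAt (fun z : E => z) (ContinuousLinearMap.id ℝ E) z :=
      fun z => hasFDerivAt_id z
    have hcst : ∀ (w z : E), HasFDerivAt (fun _ : E => w) (0 : E →L[ℝ] E) z :=
      fun w z => hasFDerivAt_const w z
    have d1 := (((hPd (z₂ - z₁)).comp z₁ ((hid z₁).const_sub z₂)).add
      ((hPd (z₃ - z₁)).comp z₁ ((hid z₁).const_sub z₃))).sub
      (hgd'.comp z₁ ((hid z₁).prodMk ((hcst z₂ z₁).prodMk (hcst z₃ z₁))))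
    have d2 := ((hPd (z₂ - z₁)).comp z₂ ((hid z₂).sub_const z₁)).sub
      (hgd'.comp z₂ ((hcst z₁ z₂).prodMk ((hid z₂).prodMk (hcst z₃ z₂))))
    have d3 := ((hPd (z₃ - z₁)).comp z₃ ((hid z₃).sub_const z₁)).sub
      (hgd'.comp z₃ ((hcst z₁ z₃).prodMk ((hcst z₂ z₃).prodMk (hid z₃))))
    have e1 := d1.fderiv
    have e2 := d2.fderiv
    have e3 := d3.fderiv
    simp only [Function.comp_def] at e1 e2 e3
    refine ContinuousLinearMap.opNorm_le_bound _ hρ.le fun w => ?_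
    have hsum : (fderiv ℝ (fun z => P (z₂ - z) + P (z₃ - z) - g (z, z₂, z₃)) z₁ +
        fderiv ℝ (fun z => P (z - z₁) - g (z₁, z, z₃)) z₂ +
        fderiv ℝ (fun z => P (z - z₁) - g (z₁, z₂, z)) z₃) w = -D (w, w, w) := by
      have hw : ((w, w, w) : E × E × E) = (w, 0, 0) + ((0, w, 0) + (0, 0, w)) := by simp
      rw [hw, map_add, map_add]
      erw [e1, e2, e3]
      simp
      ring
    rw [hsum, norm_neg]
    refine (D.le_opNorm _).trans ?_
    have : ‖((w, w, w) : E × E × E)‖ = ‖w‖ := by simp [Prod.norm_def]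
    rw [this]
    gcongr
    exact (hgd _).trans heρ

/-- By symmetry the function allowed not to be Lipschitz may be either of the first two. This
matches the hypothesis that one of `u`, `v` is locally Lipschitz, without saying which. -/
theorem HasNormalizedBump.exists_isLocalMin_add [CompleteSpace E]
    (hE : HasNormalizedBump E) {z₀ : E} {r : ℝ} (hr : 0 < r) {f₁ f₂ f₃ : E → ℝ}
    (hf₁ : LowerSemicontinuousOn f₁ (Metric.closedBall z₀ r))
    (hf₂ : LowerSemicontinuousOn f₂ (Metric.closedBall z₀ r))
    (hf₃ : LowerSemicontinuousOn f₃ (Metric.closedBall z₀ r))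
    {B : ℝ} (hB : ∀ z ∈ Metric.closedBall z₀ r, B ≤ f₁ z ∧ B ≤ f₂ z ∧ B ≤ f₃ z)
    {L : ℝ} (hL : 0 ≤ L)
    (hL₁₂ : (∀ z ∈ Metric.closedBall z₀ r, ∀ w ∈ Metric.closedBall z₀ r,
        f₁ z - f₁ w ≤ L * ‖z - w‖) ∨
      ∀ z ∈ Metric.closedBall z₀ r, ∀ w ∈ Metric.closedBall z₀ r, f₂ z - f₂ w ≤ L * ‖z - w‖)
    (hL₃ : ∀ z ∈ Metric.closedBall z₀ r, ∀ w ∈ Metric.closedBall z₀ r,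
      f₃ z - f₃ w ≤ L * ‖z - w‖)
    {c : ℝ} (hc : 0 < c)
    (hmin : ∀ z ∈ Metric.closedBall z₀ r,
      f₁ z₀ + f₂ z₀ + f₃ z₀ + c * ‖z - z₀‖ ≤ f₁ z + f₂ z + f₃ z)
    {ρ : ℝ} (hρ : 0 < ρ) :
    ∃ (z₁ z₂ z₃ : E) (g₁ g₂ g₃ : E → ℝ), ‖z₁ - z₀‖ < ρ ∧ ‖z₂ - z₀‖ < ρ ∧ ‖z₃ - z₀‖ < ρ ∧
      ContDiff ℝ 1 g₁ ∧ ContDiff ℝ 1 g₂ ∧ ContDiff ℝ 1 g₃ ∧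
      IsLocalMin (fun z => f₁ z + g₁ z) z₁ ∧ IsLocalMin (fun z => f₂ z + g₂ z) z₂ ∧
      IsLocalMin (fun z => f₃ z + g₃ z) z₃ ∧
      ‖fderiv ℝ g₁ z₁ + fderiv ℝ g₂ z₂ + fderiv ℝ g₃ z₃‖ ≤ ρ := by
  rcases hL₁₂ with h | h
  · obtain ⟨z₂, z₁, z₃, g₂, g₁, g₃, h2, h1, h3, c2, c1, c3, m2, m1, m3, hd⟩ :=
      hE.exists_isLocalMin_add_aux hr hf₂ hf₁ hf₃
        (fun z hz => ⟨(hB z hz).2.1, (hB z hz).1, (hB z hz).2.2⟩) hL h hL₃ hc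
        (fun z hz => by linarith [hmin z hz]) hρ
    exact ⟨z₁, z₂, z₃, g₁, g₂, g₃, h1, h2, h3, c1, c2, c3, m1, m2, m3, by
      rwa [add_comm (fderiv ℝ g₁ z₁)]⟩
  · exact hE.exists_isLocalMin_add_aux hr hf₁ hf₂ hf₃ hB hL h hL₃ hc hmin hρ

end Sum

/-! ### Path lengths and the Finsler distance. -/

section Distance

theorem isPiecewiseC1_of_contMDiffOn {X : Type*} [NormedAddCommGroup X] [NormedSpace ℝ X]
    {M : Type*} [TopologicalSpace M] [ChartedSpace X M] {γ : ℝ → M} {a b : ℝ}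
    (hγ : ContMDiffOn 𝓘(ℝ, ℝ) 𝓘(ℝ, X) 1 γ (Icc a b)) (hab : a ≤ b) : IsPiecewiseC1 X γ a b := by
  refine ⟨1, fun i => if i = 0 then a else b, ?_, by simp, by simp, fun i hi => ?_⟩
  · refine monotone_nat_of_le_succ fun i => ?_
    by_cases h : i = 0 <;> simp [h, hab]
  · obtain rfl : i = 0 := by omega
    simpa using hγ

variable {X : Type*} [NormedAddCommGroup X] [NormedSpace ℝ X]
  {M : Type*} [TopologicalSpace M] [ChartedSpace X M] [IsManifold 𝓘(ℝ, X) 1 M]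

namespace FinslerStructure

open MeasureTheory
open scoped ENNReal

/-- The Finsler norms as extended norms on the tangent spaces. -/
noncomputable abbrev tangentENorm (F : FinslerStructure X M) (x : M) : ENorm (TangentSpace 𝓘(ℝ, X) x) :=
  ⟨fun v => ENNReal.ofReal (F.normAt x v)⟩

theorem enormSMulClass (F : FinslerStructure X M) (x : M) :
    letI := F.tangentENorm x
    ENormSMulClass ℝ (TangentSpace 𝓘(ℝ, X) x) := by
  let := F.tangentENorm x
  refine ⟨fun r v => ?_⟩
  change ENNReal.ofReal (F.normAt x (r • v)) = ‖r‖ₑ * ENNReal.ofReal (F.normAt x v)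
  rw [map_smul_eq_mul, ENNReal.ofReal_mul (norm_nonneg _), ofReal_norm]

/-- The Finsler metric with values in `[0, ∞]`, as an infimum over `C¹` paths. -/
noncomputable def edist (F : FinslerStructure X M) (x y : M) : ℝ≥0∞ :=
  letI := F.tangentENorm
  Manifold.riemannianEDist 𝓘(ℝ, X) x y

/-- The length of a path with values in `[0, ∞]`. -/
noncomputable def pathELength (F : FinslerStructure X M) (γ : ℝ → M) (a b : ℝ) : ℝ≥0∞ :=
  letI := F.tangentENorm
  Manifold.pathELength 𝓘(ℝ, X) γ a b

theorem edist_self (F : FinslerStructure X M) (x : M) : F.edist x x = 0 :=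
  letI := F.tangentENorm
  haveI := F.enormSMulClass
  Manifold.riemannianEDist_self

theorem edist_comm (F : FinslerStructure X M) (x y : M) : F.edist x y = F.edist y x :=
  letI := F.tangentENorm
  haveI := F.enormSMulClass
  Manifold.riemannianEDist_comm

theorem edist_triangle (F : FinslerStructure X M) (x y z : M) :
    F.edist x z ≤ F.edist x y + F.edist y z :=
  letI := F.tangentENorm
  haveI := F.enormSMulClass
  Manifold.riemannianEDist_triangle

theorem edist_le_pathELength (F : FinslerStructure X M) {γ : ℝ → M} {a b : ℝ}
    (hγ : ContMDiffOn 𝓘(ℝ, ℝ) 𝓘(ℝ, X) 1 γ (Icc a b)) (hab : a ≤ b) :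
    F.edist (γ a) (γ b) ≤ F.pathELength γ a b :=
  letI := F.tangentENorm
  haveI := F.enormSMulClass
  Manifold.riemannianEDist_le_pathELength hγ rfl rfl hab

theorem exists_pathELength_lt (F : FinslerStructure X M) {x y : M} {r : ℝ≥0∞}
    (h : F.edist x y < r) :
    ∃ γ : ℝ → M, γ 0 = x ∧ γ 1 = y ∧ ContMDiff 𝓘(ℝ, ℝ) 𝓘(ℝ, X) 1 γ ∧ F.pathELength γ 0 1 < r := by
  let := F.tangentENorm
  have := F.enormSMulClass
  obtain ⟨γ, h0, h1, h2, h3, -⟩ :=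
    Manifold.exists_lt_locally_constant_of_riemannianEDist_lt h zero_lt_one
  exact ⟨γ, h0, h1, h2, h3⟩

theorem pathELength_eq_lintegral (F : FinslerStructure X M) (γ : ℝ → M) (a b : ℝ) :
    F.pathELength γ a b = ∫⁻ s in Ioo a b,
      ENNReal.ofReal (F.normAt (γ s) (mfderiv 𝓘(ℝ, ℝ) 𝓘(ℝ, X) γ s (1 : ℝ))) :=
  letI := F.tangentENorm
  Manifold.pathELength_eq_lintegral_mfderiv_Ioo

theorem pathELength_mono (F : FinslerStructure X M) (γ : ℝ → M) {a b a' b' : ℝ}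
    (h : a' ≤ a) (h' : b ≤ b') : F.pathELength γ a b ≤ F.pathELength γ a' b' :=
  letI := F.tangentENorm
  Manifold.pathELength_mono h h'

theorem continuousOn_speed (F : FinslerStructure X M) {γ : ℝ → M} {a b : ℝ}
    (hγ : ContMDiffOn 𝓘(ℝ, ℝ) 𝓘(ℝ, X) 1 γ (Icc a b)) (hab : a < b) :
    ContinuousOn (fun s => F.normAt (γ s)
      (mfderivWithin 𝓘(ℝ, ℝ) 𝓘(ℝ, X) γ (Icc a b) s (1 : ℝ))) (Icc a b) := by
  have h1 := hγ.continuousOn_tangentMapWithin le_rfl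
    (uniqueDiffOn_Icc hab).uniqueMDiffOn
  have h2 : Continuous fun s : ℝ => (⟨s, (1 : ℝ)⟩ : TangentBundle 𝓘(ℝ, ℝ) ℝ) :=
    (tangentBundleModelSpaceHomeomorph 𝓘(ℝ, ℝ)).symm.continuous.comp
      (continuous_id.prodMk continuous_const)
  exact F.continuous_normAt.comp_continuousOn
    (h1.comp h2.continuousOn (fun s hs => hs))

/-- The one-sided speed is continuous on the closed interval and agrees with the speed in the
interior; the endpoints are a null set. -/
theorem intervalIntegrable_speed (F : FinslerStructure X M) {γ : ℝ → M} {a b : ℝ}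
    (hγ : ContMDiffOn 𝓘(ℝ, ℝ) 𝓘(ℝ, X) 1 γ (Icc a b)) (hab : a ≤ b) :
    IntervalIntegrable (fun s => F.normAt (γ s) (mfderiv 𝓘(ℝ, ℝ) 𝓘(ℝ, X) γ s (1 : ℝ)))
      volume a b := by
  rcases hab.eq_or_lt with rfl | hlt
  · exact IntervalIntegrable.refl
  have h1 := (F.continuousOn_speed hγ hlt).integrableOn_Icc (μ := volume)
  rw [intervalIntegrable_iff_integrableOn_Ioo_of_le hab]
  refine (h1.mono_set Ioo_subset_Icc_self).congr_fun (fun s hs => ?_) measurableSet_Ioo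
  simp only
  rw [mfderivWithin_of_mem_nhds (Icc_mem_nhds hs.1 hs.2)]

theorem pathELength_eq_ofReal (F : FinslerStructure X M) {γ : ℝ → M} {a b : ℝ}
    (hγ : ContMDiffOn 𝓘(ℝ, ℝ) 𝓘(ℝ, X) 1 γ (Icc a b)) (hab : a ≤ b) :
    F.pathELength γ a b = ENNReal.ofReal (F.pathLength γ a b) := by
  rw [pathELength_eq_lintegral, pathLength, intervalIntegral.integral_of_le hab,
    integral_Ioc_eq_integral_Ioo, ofReal_integral_eq_lintegral_ofReal]
  · exact (intervalIntegrable_iff_integrableOn_Ioo_of_le hab).1 (F.intervalIntegrable_speed hγ hab)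
  · exact Eventually.of_forall fun s => apply_nonneg _ _

theorem pathLength_nonneg (F : FinslerStructure X M) (γ : ℝ → M) {a b : ℝ} (hab : a ≤ b) :
    0 ≤ F.pathLength γ a b :=
  intervalIntegral.integral_nonneg_of_forall hab fun _ => apply_nonneg _ _

/-- The triangle inequality along the partition replaces any smoothing of corners. Integrability is
carried through the induction so that the integral can be split. -/
theorem edist_le_pathLength (F : FinslerStructure X M) {c : ℝ → M} {a b : ℝ}
    (hc : IsPiecewiseC1 X c a b) : F.edist (c a) (c b) ≤ ENNReal.ofReal (F.pathLength c a b) := by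
  obtain ⟨n, t, ht, rfl, rfl, hsm⟩ := hc
  suffices h : ∀ i ≤ n, IntervalIntegrable
      (fun s => F.normAt (c s) (mfderiv 𝓘(ℝ, ℝ) 𝓘(ℝ, X) c s (1 : ℝ))) volume (t 0) (t i) ∧
      F.edist (c (t 0)) (c (t i)) ≤ ENNReal.ofReal (F.pathLength c (t 0) (t i)) from
    (h n le_rfl).2
  intro i
  induction i with
  | zero => exact fun _ => ⟨IntervalIntegrable.refl, by simp [edist_self]⟩
  | succ i ih =>
    intro hi
    obtain ⟨h1, h2⟩ := ih (by omega)
    have hti : t i ≤ t (i + 1) := ht i.le_succ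
    have h3 := F.intervalIntegrable_speed (hsm i hi) hti
    have h4 := F.edist_le_pathELength (hsm i hi) hti
    rw [F.pathELength_eq_ofReal (hsm i hi) hti] at h4
    refine ⟨h1.trans h3, ?_⟩
    have h5 : F.pathLength c (t 0) (t (i + 1)) =
        F.pathLength c (t 0) (t i) + F.pathLength c (t i) (t (i + 1)) :=
      (intervalIntegral.integral_add_adjacent_intervals h1 h3).symm
    rw [h5, ENNReal.ofReal_add (F.pathLength_nonneg c (ht i.zero_le)) (F.pathLength_nonneg c hti)]
    exact (F.edist_triangle _ _ _).trans (add_le_add h2 h4)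

theorem bddBelow_lengths (F : FinslerStructure X M) (p q : M) :
    BddBelow {l : ℝ | ∃ (c : ℝ → M) (a b : ℝ), a ≤ b ∧ IsPiecewiseC1 X c a b ∧
      c a = p ∧ c b = q ∧ l = F.pathLength c a b} :=
  ⟨0, by rintro _ ⟨c, a, b, hab, -, -, -, rfl⟩; exact F.pathLength_nonneg c hab⟩

theorem dist_le_pathLength (F : FinslerStructure X M) {γ : ℝ → M} {a b : ℝ}
    (hγ : ContMDiffOn 𝓘(ℝ, ℝ) 𝓘(ℝ, X) 1 γ (Icc a b)) (hab : a ≤ b) :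
    F.dist (γ a) (γ b) ≤ F.pathLength γ a b :=
  csInf_le (F.bddBelow_lengths _ _)
    ⟨γ, a, b, hab, isPiecewiseC1_of_contMDiffOn hγ hab, rfl, rfl, rfl⟩

/-- Piecewise `C¹` and `C¹` paths have the same infimum of lengths. Finiteness is needed because the
real infimum of an empty set of lengths is `0`. -/
theorem dist_eq_toReal_edist (F : FinslerStructure X M) {x y : M} (h : F.edist x y ≠ ⊤) :
    F.dist x y = (F.edist x y).toReal := by
  have key : ∀ r : ℝ≥0∞, F.edist x y < r → ∃ (γ : ℝ → M), IsPiecewiseC1 X γ 0 1 ∧ γ 0 = x ∧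
      γ 1 = y ∧ ENNReal.ofReal (F.pathLength γ 0 1) < r := by
    intro r hr
    obtain ⟨γ, h0, h1, hγ, hlt⟩ := F.exists_pathELength_lt hr
    rw [F.pathELength_eq_ofReal hγ.contMDiffOn zero_le_one] at hlt
    exact ⟨γ, isPiecewiseC1_of_contMDiffOn hγ.contMDiffOn zero_le_one, h0, h1, hlt⟩
  apply le_antisymm
  · refine le_of_forall_gt_imp_ge_of_dense fun r hr => ?_
    obtain ⟨γ, hγ, h0, h1, hlt⟩ := key (ENNReal.ofReal r) ((ENNReal.lt_ofReal_iff_toReal_lt h).2 hr)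
    refine (csInf_le (F.bddBelow_lengths _ _) ⟨γ, 0, 1, zero_le_one, hγ, h0, h1, rfl⟩).trans ?_
    exact ((ENNReal.ofReal_lt_ofReal_iff_of_nonneg (F.pathLength_nonneg γ zero_le_one)).1 hlt).le
  · obtain ⟨γ, hγ, h0, h1, -⟩ := key ⊤ h.lt_top
    refine le_csInf ⟨_, γ, 0, 1, zero_le_one, hγ, h0, h1, rfl⟩ ?_
    rintro _ ⟨c, a, b, hab, hc, rfl, rfl, rfl⟩
    exact ENNReal.toReal_le_of_le_ofReal (F.pathLength_nonneg c hab) (F.edist_le_pathLength hc)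

section Chart

variable (F : FinslerStructure X M)

theorem normAt_mfderiv_symm (e : OpenPartialHomeomorph M X) {p : X} (hp : p ∈ e.target) (v : X) :
    F.normAt (e.symm p) (mfderiv 𝓘(ℝ, X) 𝓘(ℝ, X) e.symm p v) =
      chartNorm F.normAt e (e.symm p) v := by
  unfold chartNorm
  rw [e.right_inv hp]

/-- The length of a segment in a chart. -/
theorem contMDiffOn_segment_and_pathLength_le (x₀ : M) {B : Set X} (hB : Convex ℝ B)
    (hBt : B ⊆ (chartAt X x₀).target) {Q : X → ℝ}
    (hQ : ∀ p ∈ B, ∀ v, chartNorm F.normAt (chartAt X x₀) ((chartAt X x₀).symm p) v ≤ Q v)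
    {p q : X} (hp : p ∈ B) (hq : q ∈ B) :
    ContMDiffOn 𝓘(ℝ, ℝ) 𝓘(ℝ, X) 1 (fun s : ℝ => (chartAt X x₀).symm (p + s • (q - p))) (Icc 0 1) ∧
      F.pathLength (fun s : ℝ => (chartAt X x₀).symm (p + s • (q - p))) 0 1 ≤ Q (q - p) := by
  set e := chartAt X x₀
  have hseg : ∀ s ∈ Icc (0 : ℝ) 1, p + s • (q - p) ∈ B := fun s hs =>
    hB.add_smul_sub_mem hp hq hs
  have hη : ContMDiff 𝓘(ℝ, ℝ) 𝓘(ℝ, X) 1 fun s : ℝ => p + s • (q - p) := by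
    rw [contMDiff_iff_contDiff]
    fun_prop
  have hsymm : ContMDiffOn 𝓘(ℝ, X) 𝓘(ℝ, X) 1 e.symm e.target := contMDiffOn_chart_symm
  refine ⟨hsymm.comp hη.contMDiffOn fun s hs => hBt (hseg s hs), ?_⟩
  have hder : ∀ s ∈ Icc (0 : ℝ) 1,
      F.normAt (e.symm (p + s • (q - p)))
        (mfderiv 𝓘(ℝ, ℝ) 𝓘(ℝ, X) (fun s : ℝ => e.symm (p + s • (q - p))) s (1 : ℝ)) ≤
      Q (q - p) := by
    intro s hs
    have ht := hBt (hseg s hs)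
    have h1 : MDifferentiableAt 𝓘(ℝ, X) 𝓘(ℝ, X) e.symm (p + s • (q - p)) :=
      (hsymm.contMDiffAt (e.open_target.mem_nhds ht)).mdifferentiableAt one_ne_zero
    have h2 : MDifferentiableAt 𝓘(ℝ, ℝ) 𝓘(ℝ, X) (fun s : ℝ => p + s • (q - p)) s :=
      (hη s).mdifferentiableAt one_ne_zero
    have h3 : mfderiv 𝓘(ℝ, ℝ) 𝓘(ℝ, X) (fun s : ℝ => p + s • (q - p)) s (1 : ℝ) = q - p := by
      rw [mfderiv_eq_fderiv]
      have : HasDerivAt (fun s : ℝ => p + s • (q - p)) ((1 : ℝ) • (q - p)) s :=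
        ((hasDerivAt_id s).smul_const (q - p)).const_add p
      rw [one_smul] at this
      exact this.deriv
    have h4 : mfderiv 𝓘(ℝ, ℝ) 𝓘(ℝ, X) (fun s : ℝ => e.symm (p + s • (q - p))) s (1 : ℝ) =
        mfderiv 𝓘(ℝ, X) 𝓘(ℝ, X) e.symm (p + s • (q - p)) (q - p) := by
      have := mfderiv_comp s h1 h2
      exact (DFunLike.congr_fun this (1 : ℝ)).trans
        (congrArg (mfderiv 𝓘(ℝ, X) 𝓘(ℝ, X) e.symm (p + s • (q - p))) h3)
    rw [h4]
    exact (F.normAt_mfderiv_symm e ht _).trans_le (hQ _ (hseg s hs) _)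
  have h6 := intervalIntegral.norm_integral_le_of_norm_le_const (a := (0 : ℝ)) (b := 1)
    (f := fun s => F.normAt (e.symm (p + s • (q - p)))
      (mfderiv 𝓘(ℝ, ℝ) 𝓘(ℝ, X) (fun s : ℝ => e.symm (p + s • (q - p))) s (1 : ℝ)))
    (C := Q (q - p)) (fun s hs => by
      rw [Real.norm_of_nonneg (apply_nonneg _ _)]
      rw [uIoc_of_le zero_le_one] at hs
      exact hder s ⟨hs.1.le, hs.2⟩)
  simp only [sub_zero, abs_one, mul_one] at h6
  exact (le_abs_self _).trans h6

end Chart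

end FinslerStructure

end Distance

/-! ### Finsler norms and distance compared with a chart. -/

section Local

variable {X : Type*} [NormedAddCommGroup X] [NormedSpace ℝ X]
  {M : Type*} [TopologicalSpace M] [ChartedSpace X M]

section ChartNorm

variable (N : ∀ x : M, Seminorm ℝ (TangentSpace 𝓘(ℝ, X) x)) (e : OpenPartialHomeomorph M X) (x : M)

theorem chartNorm_nonneg (v : X) : 0 ≤ chartNorm N e x v := apply_nonneg _ _

theorem chartNorm_smul (s : ℝ) (v : X) : chartNorm N e x (s • v) = |s| * chartNorm N e x v :=
  (congrArg (N (e.symm (e x)))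
    ((mfderiv 𝓘(ℝ, X) 𝓘(ℝ, X) e.symm (e x)).map_smul s v)).trans (map_smul_eq_mul _ _ _)

theorem chartNorm_sub_rev (v w : X) : chartNorm N e x (v - w) = chartNorm N e x (w - v) := by
  have := chartNorm_smul N e x (-1) (w - v)
  simpa using this

end ChartNorm

variable [IsManifold 𝓘(ℝ, X) 1 M]

namespace FinslerStructure

open MeasureTheory
open scoped ENNReal

variable (F : FinslerStructure X M)

theorem chart_mem_maximalAtlas_one (x : M) :
    chartAt X x ∈ IsManifold.maximalAtlas 𝓘(ℝ, X) 1 M :=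
  IsManifold.chart_mem_maximalAtlas x

theorem mdifferentiable_chartAt (x : M) : (chartAt X x).MDifferentiable 𝓘(ℝ, X) 𝓘(ℝ, X) :=
  mdifferentiable_chart x

theorem mfderiv_symm_mfderiv_chartAt (x₀ : M) {p : X} (hp : p ∈ (chartAt X x₀).target)
    (ξ : TangentSpace 𝓘(ℝ, X) ((chartAt X x₀).symm p)) :
    mfderiv 𝓘(ℝ, X) 𝓘(ℝ, X) (chartAt X x₀).symm p
      (mfderiv 𝓘(ℝ, X) 𝓘(ℝ, X) (chartAt X x₀) ((chartAt X x₀).symm p) ξ) = ξ := by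
  have h := (mdifferentiable_chartAt x₀).symm_comp_deriv ((chartAt X x₀).map_target hp)
  rw [(chartAt X x₀).right_inv hp] at h
  exact DFunLike.congr_fun h ξ

theorem mfderiv_mfderiv_symm_chartAt (x₀ : M) {p : X} (hp : p ∈ (chartAt X x₀).target) (v : X) :
    mfderiv 𝓘(ℝ, X) 𝓘(ℝ, X) (chartAt X x₀) ((chartAt X x₀).symm p)
      (mfderiv 𝓘(ℝ, X) 𝓘(ℝ, X) (chartAt X x₀).symm p v) = v := by
  have h := (mdifferentiable_chartAt x₀).comp_symm_deriv hp
  exact DFunLike.congr_fun h v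

theorem chartNorm_mfderiv (x₀ : M) {p : X} (hp : p ∈ (chartAt X x₀).target)
    (ξ : TangentSpace 𝓘(ℝ, X) ((chartAt X x₀).symm p)) :
    chartNorm F.normAt (chartAt X x₀) ((chartAt X x₀).symm p)
      (mfderiv 𝓘(ℝ, X) 𝓘(ℝ, X) (chartAt X x₀) ((chartAt X x₀).symm p) ξ) = F.normAt _ ξ :=
  (normAt_mfderiv_symm F _ hp _).symm.trans
    (congrArg _ (mfderiv_symm_mfderiv_chartAt x₀ hp ξ))

theorem exists_chartNorm_equiv (x₀ : M) : ∃ K : ℝ, 1 ≤ K ∧ ∀ v : X,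
    ‖v‖ ≤ K * chartNorm F.normAt (chartAt X x₀) x₀ v ∧
      chartNorm F.normAt (chartAt X x₀) x₀ v ≤ K * ‖v‖ := by
  obtain ⟨K, hK, h⟩ := F.equivalent_norm _ (chart_mem_maximalAtlas_one x₀) x₀
    (mem_chart_source X x₀)
  refine ⟨K, hK, fun v => ⟨?_, (h v).2⟩⟩
  have := (h v).1
  rwa [inv_mul_le_iff₀ (by linarith)] at this

theorem eventually_chartNorm_le (x₀ : M) {τ : ℝ} (hτ : 0 < τ) :
    ∀ᶠ p in 𝓝 (chartAt X x₀ x₀), p ∈ (chartAt X x₀).target ∧ ∀ v : X,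
      chartNorm F.normAt (chartAt X x₀) x₀ v ≤
        (1 + τ) * chartNorm F.normAt (chartAt X x₀) ((chartAt X x₀).symm p) v ∧
      chartNorm F.normAt (chartAt X x₀) ((chartAt X x₀).symm p) v ≤
        (1 + τ) * chartNorm F.normAt (chartAt X x₀) x₀ v := by
  have hx₀ := mem_chart_source X x₀
  obtain ⟨W, hW, hx₀W, -, h⟩ := F.palais _ (chart_mem_maximalAtlas_one x₀) x₀ hx₀ τ hτ
  have h1 : ∀ᶠ p in 𝓝 (chartAt X x₀ x₀), (chartAt X x₀).symm p ∈ W := by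
    have := (chartAt X x₀).continuousAt_symm ((chartAt X x₀).map_source hx₀)
    refine this.eventually_mem ?_
    rw [(chartAt X x₀).left_inv hx₀]
    exact hW.mem_nhds hx₀W
  filter_upwards [h1, (chartAt X x₀).open_target.mem_nhds ((chartAt X x₀).map_source hx₀)]
    with p hp hpt
  refine ⟨hpt, fun v => ⟨?_, (h _ hp v).2⟩⟩
  have := (h _ hp v).1
  rwa [inv_mul_le_iff₀ (by linarith)] at this

theorem eventually_edist_lt_top (x₀ : M) : ∀ᶠ y in 𝓝 x₀, F.edist x₀ y < ⊤ := by
  obtain ⟨r, hr, h⟩ := Metric.eventually_nhds_iff_ball.1 (F.eventually_chartNorm_le x₀ one_pos)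
  have hx₀ := mem_chart_source X x₀
  filter_upwards [(chartAt X x₀).continuousAt hx₀ |>.preimage_mem_nhds (Metric.ball_mem_nhds _ hr),
    (chartAt X x₀).open_source.mem_nhds hx₀] with y hy hys
  obtain ⟨h1, -⟩ := F.contMDiffOn_segment_and_pathLength_le x₀ (convex_ball _ r)
    (fun p hp => (h p hp).1) (fun p hp v => ((h p hp).2 v).2) (Metric.mem_ball_self hr) hy
  have h2 := F.edist_le_pathELength h1 zero_le_one
  rw [F.pathELength_eq_ofReal h1 zero_le_one] at h2
  simp only [zero_smul, add_zero, one_smul, add_sub_cancel, (chartAt X x₀).left_inv hx₀,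
    (chartAt X x₀).left_inv hys] at h2
  exact h2.trans_lt ENNReal.ofReal_lt_top

/-- Nearby points are joined by segments in a chart, so the points at finite distance from `x` form
a clopen set. -/
theorem edist_ne_top [ConnectedSpace M] (x y : M) : F.edist x y ≠ ⊤ := by
  have hclopen : IsClopen {y | F.edist x y < ⊤} := by
    constructor
    · rw [← isOpen_compl_iff, isOpen_iff_mem_nhds]
      intro z hz
      filter_upwards [F.eventually_edist_lt_top z] with w hw hxw
      refine hz ((F.edist_triangle x w z).trans_lt (ENNReal.add_lt_top.2 ⟨hxw, ?_⟩))
      rwa [F.edist_comm]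
    · rw [isOpen_iff_mem_nhds]
      intro z hz
      filter_upwards [F.eventually_edist_lt_top z] with w hw
      exact (F.edist_triangle x z w).trans_lt (ENNReal.add_lt_top.2 ⟨hz, hw⟩)
  have := hclopen.eq_univ ⟨x, by simp [edist_self]⟩
  have hy : y ∈ {y | F.edist x y < ⊤} := this ▸ mem_univ y
  exact hy.ne

section Connected

variable [ConnectedSpace M]

theorem dist_nonneg (x y : M) : 0 ≤ F.dist x y := by
  rw [F.dist_eq_toReal_edist (F.edist_ne_top x y)]
  exact ENNReal.toReal_nonneg

theorem dist_self (x : M) : F.dist x x = 0 := by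
  rw [F.dist_eq_toReal_edist (F.edist_ne_top x x), F.edist_self, ENNReal.toReal_zero]

theorem dist_comm (x y : M) : F.dist x y = F.dist y x := by
  rw [F.dist_eq_toReal_edist (F.edist_ne_top x y), F.dist_eq_toReal_edist (F.edist_ne_top y x),
    F.edist_comm]

theorem dist_triangle (x y z : M) : F.dist x z ≤ F.dist x y + F.dist y z := by
  rw [F.dist_eq_toReal_edist (F.edist_ne_top x y), F.dist_eq_toReal_edist (F.edist_ne_top x z),
    F.dist_eq_toReal_edist (F.edist_ne_top y z),
    ← ENNReal.toReal_add (F.edist_ne_top _ _) (F.edist_ne_top _ _)]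
  exact ENNReal.toReal_mono (ENNReal.add_ne_top.2 ⟨F.edist_ne_top _ _, F.edist_ne_top _ _⟩)
    (F.edist_triangle x y z)

end Connected

/-- While a path stays in a region of a chart where the norm of `X` is controlled by the Finsler
norms, its image in the chart is controlled by its length. -/
theorem enorm_chartAt_sub_le (x₀ : M) {u : Set M} {C : ℝ} (hC : 0 ≤ C)
    (hus : u ⊆ (chartAt X x₀).source)
    (hu : ∀ y ∈ u, ∀ v : X, ‖v‖ ≤ C * chartNorm F.normAt (chartAt X x₀) y v)
    {γ : ℝ → M} (hγ : ContMDiff 𝓘(ℝ, ℝ) 𝓘(ℝ, X) 1 γ) {t : ℝ} (ht : 0 ≤ t)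
    (hγu : ∀ s ∈ Icc 0 t, γ s ∈ u) :
    ‖chartAt X x₀ (γ t) - chartAt X x₀ (γ 0)‖ₑ ≤ ENNReal.ofReal C * F.pathELength γ 0 t := by
  set e := chartAt X x₀
  have hsm : ContMDiffOn 𝓘(ℝ, ℝ) 𝓘(ℝ, X) 1 (e ∘ γ) (Icc 0 t) :=
    (contMDiffOn_chart (x := x₀) (I := 𝓘(ℝ, X))).comp hγ.contMDiffOn fun s hs => hus (hγu s hs)
  have h1 := enorm_sub_le_lintegral_derivWithin_Icc_of_contDiffOn_Icc
    (contMDiffOn_iff_contDiffOn.1 hsm) ht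
  refine h1.trans ?_
  rw [F.pathELength_eq_lintegral, ← lintegral_const_mul' _ _ ENNReal.ofReal_ne_top,
    restrict_Ioo_eq_restrict_Icc.symm]
  refine setLIntegral_mono' measurableSet_Ioo fun s hs => ?_
  have hs' := Ioo_subset_Icc_self hs
  rw [derivWithin_of_mem_nhds (Icc_mem_nhds hs.1 hs.2), ← ENNReal.ofReal_mul hC,
    ← ofReal_norm]
  refine ENNReal.ofReal_le_ofReal ?_
  have hsrc := hus (hγu s hs')
  have h2 : MDifferentiableAt 𝓘(ℝ, X) 𝓘(ℝ, X) e (γ s) :=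
    (mdifferentiable_chartAt x₀).mdifferentiableAt hsrc
  have h3 : MDifferentiableAt 𝓘(ℝ, ℝ) 𝓘(ℝ, X) γ s := (hγ s).mdifferentiableAt one_ne_zero
  have h4 : deriv (e ∘ γ) s = mfderiv 𝓘(ℝ, X) 𝓘(ℝ, X) e (γ s)
      (mfderiv 𝓘(ℝ, ℝ) 𝓘(ℝ, X) γ s (1 : ℝ)) := by
    have h5 := mfderiv_comp s h2 h3
    rw [mfderiv_eq_fderiv] at h5
    exact DFunLike.congr_fun h5 (1 : ℝ)
  rw [h4]
  refine (hu _ (hγu s hs') _).trans (le_of_eq ?_)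
  congr 1
  have key : ∀ y ∈ e.source, ∀ ξ : TangentSpace 𝓘(ℝ, X) y,
      chartNorm F.normAt e y (mfderiv 𝓘(ℝ, X) 𝓘(ℝ, X) e y ξ) = F.normAt y ξ := by
    intro y hy
    obtain ⟨p, hp, rfl⟩ : ∃ p ∈ e.target, e.symm p = y :=
      ⟨e y, e.map_source hy, e.left_inv hy⟩
    exact F.chartNorm_mfderiv x₀ hp
  exact key _ hsrc _

/-- Points which are close for the Finsler metric are close in charts. -/
theorem exists_norm_chartAt_sub_le [RegularSpace M] [ConnectedSpace M] (x₀ : M) :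
    ∃ r C : ℝ, 0 < r ∧ 0 < C ∧ ∀ y, C * F.dist x₀ y < r →
      y ∈ (chartAt X x₀).source ∧ ‖chartAt X x₀ y - chartAt X x₀ x₀‖ ≤ C * F.dist x₀ y := by
  have hx₀ := mem_chart_source X x₀
  set e := chartAt X x₀
  obtain ⟨K, hK1, hK⟩ := F.exists_chartNorm_equiv x₀
  set C := K * (1 + 1) with hC
  have hC0 : 0 < C := by positivity
  have h1 : ∀ᶠ y in 𝓝 x₀, y ∈ e.source ∧ ∀ v : X, ‖v‖ ≤ C * chartNorm F.normAt e y v := by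
    filter_upwards [(e.continuousAt hx₀).eventually (F.eventually_chartNorm_le x₀ one_pos),
      e.open_source.mem_nhds hx₀] with y hy hys
    refine ⟨hys, fun v => (hK v).1.trans ?_⟩
    have h2 := (hy.2 v).1
    rw [e.left_inv hys] at h2
    rw [hC, mul_assoc]
    gcongr
  obtain ⟨u, hu_mem, hu_closed, hu⟩ := exists_mem_nhds_isClosed_subset h1
  obtain ⟨v, ⟨hv_mem, hv_open⟩, hv⟩ : ∃ v, (v ∈ 𝓝 x₀ ∧ IsOpen v) ∧ v ⊆ u :=
    (nhds_basis_opens' x₀).mem_iff.1 hu_mem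
  obtain ⟨r, hr, hrv⟩ : ∃ r > 0, Metric.ball (e x₀) r ⊆ e.symm ⁻¹' v := by
    refine Metric.mem_nhds_iff.1 ((e.continuousAt_symm (e.map_source hx₀)).preimage_mem_nhds ?_)
    rwa [e.left_inv hx₀]
  have hus : u ⊆ e.source := fun y hy => (hu hy).1
  -- A short path cannot leave `u`: the times up to which it has stayed in the closed set `u` can
  -- always be prolonged, since until then the chart estimate keeps it in the open set `v`.
  have hpath : ∀ γ : ℝ → M, γ 0 = x₀ → ContMDiff 𝓘(ℝ, ℝ) 𝓘(ℝ, X) 1 γ →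
      ENNReal.ofReal C * F.pathELength γ 0 1 < ENNReal.ofReal r → ∀ s ∈ Icc (0 : ℝ) 1, γ s ∈ u := by
    intro γ hγ0 hγ hlt
    have A_closed : IsClosed (γ ⁻¹' u ∩ Icc 0 1) :=
      (hu_closed.preimage hγ.continuous).inter isClosed_Icc
    refine A_closed.Icc_subset_of_forall_mem_nhdsGT_of_Icc_subset
      (by simpa [hγ0] using mem_of_mem_nhds hu_mem) ?_
    rintro t ⟨ht0, ht1⟩ ht
    suffices γ t ∈ v from
      hγ.continuous.continuousWithinAt <| mem_of_superset (hv_open.mem_nhds this) hv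
    have h3 := F.enorm_chartAt_sub_le x₀ hC0.le hus (fun y hy => (hu hy).2) hγ ht0
      fun s hs => ht hs
    have h4 : ‖e (γ t) - e (γ 0)‖ₑ < ENNReal.ofReal r :=
      h3.trans_lt (lt_of_le_of_lt (by gcongr; exact F.pathELength_mono γ le_rfl ht1.le) hlt)
    rw [← ofReal_norm, ENNReal.ofReal_lt_ofReal_iff hr, hγ0] at h4
    have h5 := hrv (mem_ball_iff_norm.2 h4)
    rwa [mem_preimage, e.left_inv (hus (ht ⟨ht0, le_rfl⟩))] at h5
  have hmain : ∀ y, ∀ ℓ : ℝ, F.dist x₀ y < ℓ → C * ℓ ≤ r →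
      y ∈ e.source ∧ ‖e y - e x₀‖ ≤ C * ℓ := by
    intro y ℓ hℓ hCℓ
    rw [F.dist_eq_toReal_edist (F.edist_ne_top _ _),
      ← ENNReal.lt_ofReal_iff_toReal_lt (F.edist_ne_top _ _)] at hℓ
    obtain ⟨γ, h0, h1, hγ, hlt⟩ := F.exists_pathELength_lt hℓ
    have h2 : ENNReal.ofReal C * F.pathELength γ 0 1 < ENNReal.ofReal (C * ℓ) := by
      rw [ENNReal.ofReal_mul hC0.le]
      exact (ENNReal.mul_lt_mul_iff_right (by simpa using hC0) ENNReal.ofReal_ne_top).2 hlt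
    have h3 := hpath γ h0 hγ (h2.trans_le (ENNReal.ofReal_le_ofReal hCℓ))
    have h4 := F.enorm_chartAt_sub_le x₀ hC0.le hus (fun y hy => (hu hy).2) hγ zero_le_one h3
    rw [h0, h1] at h4
    have h5 := h4.trans h2.le
    have hℓ0 : 0 ≤ C * ℓ := by
      by_contra! hneg
      rw [ENNReal.ofReal_of_nonpos hneg.le] at h2
      exact not_lt_bot h2
    rw [← ofReal_norm, ENNReal.ofReal_le_ofReal_iff hℓ0] at h5
    exact ⟨h1 ▸ hus (h3 1 ⟨zero_le_one, le_rfl⟩), h5⟩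
  refine ⟨r, C, hr, hC0, fun y hy => ?_⟩
  have hy' : F.dist x₀ y < r / C := by rwa [lt_div_iff₀' hC0]
  refine ⟨(hmain y (r / C) hy' (by field_simp; exact le_rfl)).1, ?_⟩
  have : ∀ ℓ, F.dist x₀ y < ℓ → ℓ < r / C → C⁻¹ * ‖e y - e x₀‖ ≤ ℓ := fun ℓ h1 h2 => by
    rw [inv_mul_le_iff₀ hC0]
    exact (hmain y ℓ h1 (by rw [lt_div_iff₀' hC0] at h2; exact h2.le)).2
  rw [← inv_mul_le_iff₀ hC0]
  refine le_of_forall_gt_imp_ge_of_dense fun ℓ hℓ => ?_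
  obtain ⟨m, hm1, hm2⟩ := exists_between (lt_min hℓ hy')
  exact (this m hm1 (hm2.trans_le (min_le_right _ _))).trans (hm2.trans_le (min_le_left _ _)).le

/-- Completeness is stated for the Finsler distance and semicontinuity for the topology of `M`;
Ekeland's principle needs both along the same sequence. -/
theorem tendsto_of_tendsto_dist [RegularSpace M] [ConnectedSpace M] {s : ℕ → M} {x : M}
    (h : Tendsto (fun n => F.dist (s n) x) atTop (𝓝 0)) : Tendsto s atTop (𝓝 x) := by
  obtain ⟨r, C, hr, hC, hrC⟩ := F.exists_norm_chartAt_sub_le x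
  have hx := mem_chart_source X x
  set e := chartAt X x
  simp_rw [fun n => F.dist_comm (s n) x] at h
  have h1 : Tendsto (fun n => C * F.dist x (s n)) atTop (𝓝 0) := by simpa using h.const_mul C
  have h2 : ∀ᶠ n in atTop, C * F.dist x (s n) < r := h1.eventually_lt_const hr
  have h3 : Tendsto (fun n => e (s n)) atTop (𝓝 (e x)) := by
    rw [tendsto_iff_norm_sub_tendsto_zero]
    refine squeeze_zero' (Eventually.of_forall fun n => norm_nonneg _) ?_ h1
    filter_upwards [h2] with n hn using (hrC _ hn).2
  have h4 := (e.continuousAt_symm (e.map_source hx)).tendsto.comp h3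
  rw [e.left_inv hx] at h4
  refine h4.congr' ?_
  filter_upwards [h2] with n hn using e.left_inv (hrC _ hn).1

/-- Near the center of a chart, the Finsler metric is bounded above by the norm at the center, up
to a factor close to one, and below by a multiple of the norm. -/
theorem exists_ball_dist_le [RegularSpace M] [ConnectedSpace M] (x₀ : M) {τ : ℝ} (hτ : 0 < τ) :
    ∃ r c : ℝ, 0 < r ∧ 0 < c ∧ (∀ p ∈ Metric.ball (chartAt X x₀ x₀) r,
      p ∈ (chartAt X x₀).target ∧ (∀ v : X,
        chartNorm F.normAt (chartAt X x₀) x₀ v ≤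
          (1 + τ) * chartNorm F.normAt (chartAt X x₀) ((chartAt X x₀).symm p) v ∧
        chartNorm F.normAt (chartAt X x₀) ((chartAt X x₀).symm p) v ≤
          (1 + τ) * chartNorm F.normAt (chartAt X x₀) x₀ v) ∧
      c * ‖p - chartAt X x₀ x₀‖ ≤ F.dist ((chartAt X x₀).symm p) x₀ ∧
      ∀ q ∈ Metric.ball (chartAt X x₀ x₀) r,
        F.dist ((chartAt X x₀).symm p) ((chartAt X x₀).symm q) ≤
          (1 + τ) * chartNorm F.normAt (chartAt X x₀) x₀ (p - q)) := by
  obtain ⟨r₁, hr₁, h₁⟩ := Metric.eventually_nhds_iff_ball.1 (F.eventually_chartNorm_le x₀ hτ)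
  obtain ⟨r₂, C, hr₂, hC, h₂⟩ := F.exists_norm_chartAt_sub_le x₀
  refine ⟨min r₁ r₂, C⁻¹, by positivity, by positivity, fun p hp => ?_⟩
  have hsub := Metric.ball_subset_ball (x := chartAt X x₀ x₀) (min_le_left r₁ r₂)
  refine ⟨(h₁ p (hsub hp)).1, (h₁ p (hsub hp)).2, ?_, fun q hq => ?_⟩
  · rw [inv_mul_le_iff₀ hC, F.dist_comm]
    by_cases h : C * F.dist x₀ ((chartAt X x₀).symm p) < r₂
    · have := (h₂ _ h).2
      rwa [(chartAt X x₀).right_inv (h₁ p (hsub hp)).1] at this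
    -- A point at Finsler distance at least `r₂ / C` satisfies the bound trivially, as `p` lies in
    -- the ball of radius `r₂`.
    · have : ‖p - chartAt X x₀ x₀‖ < min r₁ r₂ := mem_ball_iff_norm.1 hp
      linarith [this.trans_le (min_le_right _ _)]
  · obtain ⟨h3, h4⟩ := F.contMDiffOn_segment_and_pathLength_le x₀ (convex_ball _ r₁)
      (fun p hp => (h₁ p hp).1) (fun p hp v => ((h₁ p hp).2 v).2) (hsub hp) (hsub hq)
    have h5 := F.dist_le_pathLength h3 zero_le_one
    simp only [zero_smul, add_zero, one_smul, add_sub_cancel] at h5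
    rw [chartNorm_sub_rev]
    exact h5.trans h4

end FinslerStructure

end Local

/-! ### Dual norms in charts and transfer of test functions to the manifold. -/

section TestFunctions

variable {X : Type*} [NormedAddCommGroup X] [NormedSpace ℝ X]
  {M : Type*} [TopologicalSpace M] [ChartedSpace X M] [IsManifold 𝓘(ℝ, X) 1 M]

namespace FinslerStructure

variable (F : FinslerStructure X M)

theorem dualNorm_le (x₀ : M) {p : X} (hp : p ∈ (chartAt X x₀).target)
    {Δ : TangentSpace 𝓘(ℝ, X) ((chartAt X x₀).symm p) →L[ℝ] ℝ} {a : X → ℝ}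
    (hΔ : ∀ ξ, Δ ξ = a (mfderiv 𝓘(ℝ, X) 𝓘(ℝ, X) (chartAt X x₀) ((chartAt X x₀).symm p) ξ))
    {c : ℝ} (hc : 0 ≤ c)
    (ha : ∀ v, |a v| ≤ c * chartNorm F.normAt (chartAt X x₀) ((chartAt X x₀).symm p) v) :
    F.dualNorm _ Δ ≤ c := by
  refine Real.sSup_le ?_ hc
  rintro _ ⟨ξ, hξ, rfl⟩
  rw [hΔ]
  refine (ha _).trans (le_of_eq ?_)
  exact (congrArg (c * ·) ((F.chartNorm_mfderiv x₀ hp ξ).trans hξ)).trans (mul_one c)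

theorem dualNorm_nonneg (x : M) (Δ : TangentSpace 𝓘(ℝ, X) x →L[ℝ] ℝ) : 0 ≤ F.dualNorm x Δ :=
  Real.sSup_nonneg (by rintro _ ⟨ξ, -, rfl⟩; exact abs_nonneg _)

/-- Normalize the vector. The a priori bound `ha` settles the case of norm zero and keeps the
supremum finite; the real `sSup` of an unbounded set would be `0`. -/
theorem abs_le_dualNorm_mul (x₀ : M) {p : X} (hp : p ∈ (chartAt X x₀).target)
    {Δ : TangentSpace 𝓘(ℝ, X) ((chartAt X x₀).symm p) →L[ℝ] ℝ} {a : X → ℝ}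
    (hΔ : ∀ ξ, Δ ξ = a (mfderiv 𝓘(ℝ, X) 𝓘(ℝ, X) (chartAt X x₀) ((chartAt X x₀).symm p) ξ))
    {c : ℝ} (ha : ∀ v, |a v| ≤ c * chartNorm F.normAt (chartAt X x₀) ((chartAt X x₀).symm p) v)
    (v : X) :
    |a v| ≤ F.dualNorm _ Δ * chartNorm F.normAt (chartAt X x₀) ((chartAt X x₀).symm p) v := by
  set n := chartNorm F.normAt (chartAt X x₀) ((chartAt X x₀).symm p) v with hn
  have hn0 : 0 ≤ n := chartNorm_nonneg _ _ _ _
  rcases hn0.eq_or_lt with h0 | hpos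
  · have := ha v
    rw [← hn, ← h0, mul_zero] at this
    rwa [← h0, mul_zero]
  let ξ : TangentSpace 𝓘(ℝ, X) ((chartAt X x₀).symm p) :=
    mfderiv 𝓘(ℝ, X) 𝓘(ℝ, X) (chartAt X x₀).symm p v
  have hξn : F.normAt _ ξ = n := F.normAt_mfderiv_symm _ hp v
  have hξa : Δ ξ = a v := (hΔ ξ).trans (congrArg a (mfderiv_mfderiv_symm_chartAt x₀ hp v))
  have hbdd : BddAbove {r : ℝ | ∃ ξ : TangentSpace 𝓘(ℝ, X) ((chartAt X x₀).symm p),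
      F.normAt _ ξ = 1 ∧ r = |Δ ξ|} := by
    refine ⟨c, ?_⟩
    rintro _ ⟨ξ, hξ, rfl⟩
    rw [hΔ]
    refine (ha _).trans (le_of_eq ?_)
    exact (congrArg (c * ·) ((F.chartNorm_mfderiv x₀ hp ξ).trans hξ)).trans (mul_one c)
  have h1 : |Δ (n⁻¹ • ξ)| ≤ F.dualNorm _ Δ := by
    refine le_csSup hbdd ⟨n⁻¹ • ξ, ?_, rfl⟩
    rw [map_smul_eq_mul, hξn, Real.norm_eq_abs, abs_of_pos (by positivity),
      inv_mul_cancel₀ hpos.ne']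
  rw [map_smul, hξa, smul_eq_mul, abs_mul, abs_of_pos (by positivity), inv_mul_le_iff₀ hpos,
    mul_comm] at h1
  exact h1

end FinslerStructure

/-- A `C¹` function near a point of a chart is extended to a `C¹` function on the manifold with the
same derivatives at this point. -/
theorem exists_contMDiff_eq_chart [RegularSpace M] (hX : HasNormalizedBump X) (x₀ : M) {p : X}
    (hp : p ∈ (chartAt X x₀).target) {g : ℝ × X → ℝ} (hg : ContDiff ℝ 1 g) (t : ℝ) :
    ∃ G : ℝ × M → ℝ, ContMDiff (𝓘(ℝ, ℝ).prod 𝓘(ℝ, X)) 𝓘(ℝ, ℝ) 1 G ∧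
      (∀ᶠ z in 𝓝 (t, (chartAt X x₀).symm p), G z = g (z.1, chartAt X x₀ z.2)) ∧
      timePart (mfderiv (𝓘(ℝ, ℝ).prod 𝓘(ℝ, X)) 𝓘(ℝ, ℝ) G (t, (chartAt X x₀).symm p)) =
        fderiv ℝ g (t, p) (1, 0) ∧
      ∀ ξ, spacePart (mfderiv (𝓘(ℝ, ℝ).prod 𝓘(ℝ, X)) 𝓘(ℝ, ℝ) G (t, (chartAt X x₀).symm p)) ξ =
        fderiv ℝ g (t, p)
          (0, mfderiv 𝓘(ℝ, X) 𝓘(ℝ, X) (chartAt X x₀) ((chartAt X x₀).symm p) ξ) := by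
  classical
  set e := chartAt X x₀ with he
  set x := e.symm p with hx
  have hxs : x ∈ e.source := e.map_target hp
  have hex : e x = p := e.right_inv hp
  obtain ⟨b, K, R, hb, -, -, -, hb0, hR, hbR⟩ := hX
  -- The cutoff will vanish on the chart domain outside the closed set `u`, so the extension by zero
  -- is zero on the open complement of `u` and hence `C¹` at points outside the chart.
  obtain ⟨u, hu_mem, hu_closed, hus⟩ := exists_mem_nhds_isClosed_subset (e.open_source.mem_nhds hxs)
  obtain ⟨r, hr, hru⟩ : ∃ r > 0, Metric.ball p r ⊆ e.target ∩ e.symm ⁻¹' u :=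
    Metric.mem_nhds_iff.1 (inter_mem (e.open_target.mem_nhds hp)
      ((e.continuousAt_symm hp).preimage_mem_nhds hu_mem))
  set k := R / r with hk
  have hk0 : 0 < k := by positivity
  -- The bump equals `1` only at its centre; this composition is `1` wherever `b ≥ 1/2`, hence near
  -- `p`, which leaves the derivative of `g` unchanged.
  let χ : X → ℝ := fun q => Real.smoothTransition (2 * b (k • (q - p)))
  have hχ : ContDiff ℝ 1 χ := Real.smoothTransition.contDiff.comp
    (contDiff_const.mul (hb.comp ((contDiff_id.sub contDiff_const).const_smul k)))
  have hχ0 : ∀ q, q ∉ Metric.ball p r → χ q = 0 := by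
    intro q hq
    rw [mem_ball_iff_norm, not_lt] at hq
    have : R ≤ ‖k • (q - p)‖ := by
      rw [norm_smul, Real.norm_eq_abs, abs_of_pos hk0, hk, div_mul_eq_mul_div, le_div_iff₀ hr]
      gcongr
    simp [χ, hbR _ this]
  have hχ1 : ∀ᶠ q in 𝓝 p, χ q = 1 := by
    have h1 : Continuous fun q => b (k • (q - p)) := by
      have := hb.continuous
      fun_prop
    have h2 : ∀ᶠ q in 𝓝 p, (1 / 2 : ℝ) < b (k • (q - p)) :=
      continuousAt_const.eventually_lt h1.continuousAt (by simp [hb0]; norm_num)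
    filter_upwards [h2] with q hq
    exact Real.smoothTransition.one_of_one_le (by linarith)
  have hmaps : ∀ z : ℝ × M, z.2 ∈ e.source →
      ContMDiffAt (𝓘(ℝ, ℝ).prod 𝓘(ℝ, X)) 𝓘(ℝ, ℝ × X) 1 (fun z : ℝ × M => (z.1, e z.2)) z := by
    intro z hz
    refine contMDiffAt_fst.prodMk_space ?_
    have h1 : ContMDiffAt 𝓘(ℝ, X) 𝓘(ℝ, X) 1 e z.2 :=
      (contMDiffOn_chart (x := x₀)).contMDiffAt (e.open_source.mem_nhds hz)
    exact ContMDiffAt.comp (I' := 𝓘(ℝ, X)) z h1 contMDiffAt_snd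
  let G : ℝ × M → ℝ := fun z => if z.2 ∈ e.source then χ (e z.2) * g (z.1, e z.2) else 0
  have hG : ContMDiff (𝓘(ℝ, ℝ).prod 𝓘(ℝ, X)) 𝓘(ℝ, ℝ) 1 G := by
    intro z
    by_cases hz : z.2 ∈ e.source
    · have h1 : ContDiff ℝ 1 fun w : ℝ × X => χ w.2 * g w :=
        (hχ.comp contDiff_snd).mul hg
      refine (ContMDiffAt.comp z h1.contMDiff.contMDiffAt (hmaps z hz)).congr_of_eventuallyEq ?_
      filter_upwards [continuous_snd.continuousAt.preimage_mem_nhds (e.open_source.mem_nhds hz)]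
        with w hw
      have hw' : w.2 ∈ e.source := hw
      simp [G, hw']
    · have hzu : z.2 ∉ u := fun h => hz (hus h)
      refine (contMDiffAt_const (c := (0 : ℝ))).congr_of_eventuallyEq ?_
      filter_upwards [continuous_snd.continuousAt.preimage_mem_nhds
        (hu_closed.isOpen_compl.mem_nhds hzu)] with w hw
      have hw' : w.2 ∉ u := hw
      by_cases hws : w.2 ∈ e.source
      · have : e w.2 ∉ Metric.ball p r := fun h => hw' (by
          have := (hru h).2
          rwa [mem_preimage, e.left_inv hws] at this)
        simp [G, hχ0 _ this]
      · simp [G, hws]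
  have hGg : ∀ᶠ z in 𝓝 (t, x), G z = g (z.1, e z.2) := by
    have h1 : ContinuousAt (fun z : ℝ × M => e z.2) (t, x) :=
      ContinuousAt.comp (f := fun z : ℝ × M => z.2) (e.continuousAt hxs) continuousAt_snd
    have h2 : ∀ᶠ z : ℝ × M in 𝓝 (t, x), χ (e z.2) = 1 := by
      rw [ContinuousAt, hex] at h1
      exact h1.eventually hχ1
    filter_upwards [h2, continuous_snd.continuousAt.preimage_mem_nhds
      (e.open_source.mem_nhds (show ((t, x) : ℝ × M).2 ∈ e.source from hxs))] with z hz hzs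
    have hzs' : z.2 ∈ e.source := hzs
    simp [G, hzs', hz]
  have hGd : MDifferentiableAt (𝓘(ℝ, ℝ).prod 𝓘(ℝ, X)) 𝓘(ℝ, ℝ) G (t, x) :=
    (hG _).mdifferentiableAt one_ne_zero
  have hgd : HasFDerivAt g (fderiv ℝ g (t, p)) (t, p) :=
    (hg.differentiable one_ne_zero _).hasFDerivAt
  refine ⟨G, hG, hGg, ?_, fun ξ => ?_⟩
  · have hι : ContMDiff 𝓘(ℝ, ℝ) (𝓘(ℝ, ℝ).prod 𝓘(ℝ, X)) 1 fun s : ℝ => ((s, x) : ℝ × M) :=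
      contMDiff_id.prodMk contMDiff_const
    have h1 := mfderiv_comp t hGd ((hι t).mdifferentiableAt one_ne_zero)
    have h2 : (G ∘ fun s : ℝ => ((s, x) : ℝ × M)) =ᶠ[𝓝 t] fun s => g (s, p) := by
      have h3 : ContinuousAt (fun s : ℝ => ((s, x) : ℝ × M)) t := by fun_prop
      filter_upwards [h3.eventually hGg] with s hs
      simp only [Function.comp_apply]
      rw [hs, hex]
    have h4 : HasDerivAt (fun s => g (s, p)) (fderiv ℝ g (t, p) (1, 0)) t :=
      hgd.comp_hasDerivAt (f := fun s : ℝ => (s, p)) t ((hasDerivAt_id t).prodMk (hasDerivAt_const t p))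
    rw [h2.mfderiv_eq, mfderiv_eq_fderiv] at h1
    exact (DFunLike.congr_fun h1 (1 : ℝ)).symm.trans h4.deriv
  · have hι : ContMDiff 𝓘(ℝ, X) (𝓘(ℝ, ℝ).prod 𝓘(ℝ, X)) 1 fun y : M => ((t, y) : ℝ × M) :=
      contMDiff_const.prodMk contMDiff_id
    have h1 := mfderiv_comp x hGd ((hι x).mdifferentiableAt one_ne_zero)
    have h2 : (G ∘ fun y : M => ((t, y) : ℝ × M)) =ᶠ[𝓝 x] (fun q => g (t, q)) ∘ e := by
      have h3 : ContinuousAt (fun y : M => ((t, y) : ℝ × M)) x := by fun_prop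
      filter_upwards [h3.eventually hGg] with s hs
      exact hs
    have h4 : HasFDerivAt (fun q => g (t, q))
        ((fderiv ℝ g (t, p)).comp (ContinuousLinearMap.inr ℝ ℝ X)) (e x) := by
      rw [hex]
      exact hgd.comp p (hasFDerivAt_prodMk_right t p)
    have h5 : MDifferentiableAt 𝓘(ℝ, X) 𝓘(ℝ, X) e x :=
      (FinslerStructure.mdifferentiable_chartAt x₀).mdifferentiableAt hxs
    have h6 := mfderiv_comp x h4.hasMFDerivAt.mdifferentiableAt h5
    rw [h4.hasMFDerivAt.mfderiv] at h6
    rw [h2.mfderiv_eq] at h1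
    exact (DFunLike.congr_fun h1 ξ).symm.trans (DFunLike.congr_fun h6 ξ)

variable [RegularSpace M]

/-- A local minimum in a chart gives an element of the subdifferential. -/
theorem exists_mem_subdifferential (hX : HasNormalizedBump X) (x₀ : M) {p : X}
    (hp : p ∈ (chartAt X x₀).target) {g : ℝ × X → ℝ} (hg : ContDiff ℝ 1 g) (t : ℝ)
    {f : ℝ × M → ℝ}
    (hmin : IsLocalMin (fun w : ℝ × X => f (w.1, (chartAt X x₀).symm w.2) + g w) (t, p)) :
    ∃ Λ ∈ subdifferential (𝓘(ℝ, ℝ).prod 𝓘(ℝ, X)) (Ioi 0 ×ˢ univ) f (t, (chartAt X x₀).symm p),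
      timePart Λ = -fderiv ℝ g (t, p) (1, 0) ∧
      ∀ ξ, spacePart Λ ξ = -fderiv ℝ g (t, p)
          (0, mfderiv 𝓘(ℝ, X) 𝓘(ℝ, X) (chartAt X x₀) ((chartAt X x₀).symm p) ξ) := by
  obtain ⟨G, hG, hGg, h1, h2⟩ := exists_contMDiff_eq_chart hX x₀ hp hg.neg t
  refine ⟨_, ⟨G, hG.contMDiffOn, ?_, rfl⟩, ?_, fun ξ => ?_⟩
  · have hxs := (chartAt X x₀).map_target hp
    have hex := (chartAt X x₀).right_inv hp
    have h3 : Tendsto (fun z : ℝ × M => (z.1, chartAt X x₀ z.2))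
        (𝓝 (t, (chartAt X x₀).symm p)) (𝓝 (t, p)) := by
      nth_rw 2 [← hex]
      exact continuousAt_fst.prodMk (ContinuousAt.comp (f := fun z : ℝ × M => z.2)
        ((chartAt X x₀).continuousAt hxs) continuousAt_snd)
    have h4 : ∀ᶠ z : ℝ × M in 𝓝 (t, (chartAt X x₀).symm p), f (t, (chartAt X x₀).symm p) + g (t, p) ≤
        f (z.1, (chartAt X x₀).symm (chartAt X x₀ z.2)) + g (z.1, chartAt X x₀ z.2) :=
      h3.eventually hmin
    have h5 := hGg.self_of_nhds
    simp only [hex] at h5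
    refine IsLocalMin.on ?_ _
    filter_upwards [h4, hGg, continuous_snd.continuousAt.preimage_mem_nhds
      ((chartAt X x₀).open_source.mem_nhds
        (show ((t, (chartAt X x₀).symm p) : ℝ × M).2 ∈ _ from hxs))] with z hz1 hz2 hz3
    have hz3' : z.2 ∈ (chartAt X x₀).source := hz3
    rw [(chartAt X x₀).left_inv hz3'] at hz1
    rw [h5, hz2]
    simp only [Prod.mk.eta] at hz1
    linarith
  · rw [h1, fderiv_fun_neg]
    rfl
  · rw [h2, fderiv_fun_neg]
    rfl

/-- A local maximum in a chart gives an element of the superdifferential. -/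
theorem exists_mem_superdifferential (hX : HasNormalizedBump X) (x₀ : M) {p : X}
    (hp : p ∈ (chartAt X x₀).target) {g : ℝ × X → ℝ} (hg : ContDiff ℝ 1 g) (t : ℝ)
    {f : ℝ × M → ℝ}
    (hmin : IsLocalMin (fun w : ℝ × X => -f (w.1, (chartAt X x₀).symm w.2) + g w) (t, p)) :
    ∃ Λ ∈ superdifferential (𝓘(ℝ, ℝ).prod 𝓘(ℝ, X)) (Ioi 0 ×ˢ univ) f (t, (chartAt X x₀).symm p),
      timePart Λ = fderiv ℝ g (t, p) (1, 0) ∧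
      ∀ ξ, spacePart Λ ξ = fderiv ℝ g (t, p)
          (0, mfderiv 𝓘(ℝ, X) 𝓘(ℝ, X) (chartAt X x₀) ((chartAt X x₀).symm p) ξ) := by
  obtain ⟨_, ⟨G, hG, hGmin, rfl⟩, h1, h2⟩ :=
    exists_mem_subdifferential (f := fun z => -f z) hX x₀ hp hg t hmin
  have hneg : mfderiv (𝓘(ℝ, ℝ).prod 𝓘(ℝ, X)) 𝓘(ℝ, ℝ) (fun z => -G z)
      (t, (chartAt X x₀).symm p) =
      -mfderiv (𝓘(ℝ, ℝ).prod 𝓘(ℝ, X)) 𝓘(ℝ, ℝ) G (t, (chartAt X x₀).symm p) := mfderiv_neg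
  refine ⟨_, ⟨fun z => -G z, hG.neg, ?_, rfl⟩, ?_, fun ξ => ?_⟩
  · filter_upwards [hGmin] with z hz
    linarith
  · rw [hneg]
    have : timePart (-mfderiv (𝓘(ℝ, ℝ).prod 𝓘(ℝ, X)) 𝓘(ℝ, ℝ) G (t, (chartAt X x₀).symm p)) =
      -timePart (mfderiv (𝓘(ℝ, ℝ).prod 𝓘(ℝ, X)) 𝓘(ℝ, ℝ) G (t, (chartAt X x₀).symm p)) := rfl
    rw [this, h1, neg_neg]
  · rw [hneg]
    have : spacePart (-mfderiv (𝓘(ℝ, ℝ).prod 𝓘(ℝ, X)) 𝓘(ℝ, ℝ) G (t, (chartAt X x₀).symm p)) ξ =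
      -spacePart (mfderiv (𝓘(ℝ, ℝ).prod 𝓘(ℝ, X)) 𝓘(ℝ, ℝ) G (t, (chartAt X x₀).symm p)) ξ := rfl
    rw [this, h2, neg_neg]

end TestFunctions

/-! ### Close sub- and supergradients near an almost minimum. -/

section Comparison

variable {X : Type*} [NormedAddCommGroup X] [NormedSpace ℝ X]

theorem abs_fderiv_le_of_isLocalMin_add_of_lipschitz {Q : X → ℝ}
    (hQ : ∀ (s : ℝ) v, Q (s • v) = |s| * Q v) {f g : ℝ × X → ℝ} {z : ℝ × X} {ℓ : ℝ}
    (hg : ContDiff ℝ 1 g) (hmin : IsLocalMin (fun w => f w + g w) z)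
    (hf : ∀ᶠ w in 𝓝 z, f w - f z ≤ ℓ * (|w.1 - z.1| + Q (w.2 - z.2))) (a : ℝ) (v : X) :
    |fderiv ℝ g z (a, v)| ≤ ℓ * (|a| + Q v) := by
  refine abs_fderiv_le_of_isLocalMin_add (hg.differentiable one_ne_zero _) hmin ?_
  filter_upwards [hf] with w hw s hs
  refine hw.trans (le_of_eq ?_)
  subst hs
  simp only [Prod.fst_add, Prod.smul_fst, Prod.snd_add, Prod.smul_snd, add_sub_cancel_left,
    smul_eq_mul, abs_mul, hQ]
  ring

variable {M : Type*} [TopologicalSpace M] [ChartedSpace X M] [IsManifold 𝓘(ℝ, X) 1 M]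

namespace FinslerStructure

variable (F : FinslerStructure X M)

/-- Covectors at different points are compared through the fixed reference norm `Q`; each change
between `Q` and the norm at a point costs a factor `1 + τ`. -/
theorem dualNorm_le_dualNorm_add (x₀ : M) {p q : X} (hp : p ∈ (chartAt X x₀).target)
    (hq : q ∈ (chartAt X x₀).target) {Q : X → ℝ} {τ σ ℓ : ℝ} (hτ : 0 ≤ τ) (hσ : 0 ≤ σ)
    (hℓ : 0 ≤ ℓ)
    (hQp : ∀ v, Q v ≤ (1 + τ) * chartNorm F.normAt (chartAt X x₀) ((chartAt X x₀).symm p) v)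
    (hQq : ∀ v, Q v ≤ (1 + τ) * chartNorm F.normAt (chartAt X x₀) ((chartAt X x₀).symm q) v)
    (hQq' : ∀ v, chartNorm F.normAt (chartAt X x₀) ((chartAt X x₀).symm q) v ≤ (1 + τ) * Q v)
    {Δp : TangentSpace 𝓘(ℝ, X) ((chartAt X x₀).symm p) →L[ℝ] ℝ} {a : X → ℝ}
    (ha : ∀ ξ, Δp ξ = a (mfderiv 𝓘(ℝ, X) 𝓘(ℝ, X) (chartAt X x₀) ((chartAt X x₀).symm p) ξ))
    {Δq : TangentSpace 𝓘(ℝ, X) ((chartAt X x₀).symm q) →L[ℝ] ℝ} {b : X → ℝ}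
    (hb : ∀ ξ, Δq ξ = b (mfderiv 𝓘(ℝ, X) 𝓘(ℝ, X) (chartAt X x₀) ((chartAt X x₀).symm q) ξ))
    (hab : ∀ v, |a v - b v| ≤ σ * Q v) (hbQ : ∀ v, |b v| ≤ ℓ * Q v) :
    F.dualNorm _ Δq ≤ ℓ * (1 + τ) ∧
      F.dualNorm _ Δp ≤ (F.dualNorm _ Δq * (1 + τ) + σ) * (1 + τ) := by
  have hbn : ∀ v, |b v| ≤
      ℓ * (1 + τ) * chartNorm F.normAt (chartAt X x₀) ((chartAt X x₀).symm q) v := fun v =>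
    (hbQ v).trans (by rw [mul_assoc]; gcongr; exact hQq v)
  have hd := F.dualNorm_nonneg _ Δq
  refine ⟨F.dualNorm_le x₀ hq hb (by positivity) hbn,
    F.dualNorm_le x₀ hp ha (by positivity) fun v => ?_⟩
  have h1 := F.abs_le_dualNorm_mul x₀ hq hb hbn v
  have h2 : |a v| ≤ |a v - b v| + |b v| := by simpa using abs_add_le (a v - b v) (b v)
  have h3 : F.dualNorm _ Δq * chartNorm F.normAt (chartAt X x₀) ((chartAt X x₀).symm q) v ≤
      F.dualNorm _ Δq * ((1 + τ) * Q v) := by gcongr; exact hQq' v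
  calc |a v| ≤ (F.dualNorm _ Δq * (1 + τ) + σ) * Q v := by linarith [hab v]
    _ ≤ _ := by rw [mul_assoc]; gcongr; exact hQp v

end FinslerStructure

variable [CompleteSpace X] [RegularSpace M] [ConnectedSpace M]

set_option maxHeartbeats 1000000 in
/-- At a point where `v - u + θ` has a local minimum up to a small multiple of the distance, there
are close points with elements of the subdifferential of `v` and of the superdifferential of `u`
which are close to each other. -/
theorem exists_close_differentials (hX : HasNormalizedBump X) (F : FinslerStructure X M)
    {u v : ℝ × M → ℝ} (hu : UpperSemicontinuousOn u (Ici 0 ×ˢ univ))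
    (hv : LowerSemicontinuousOn v (Ici 0 ×ˢ univ)) {t₀ : ℝ} {x₀ : M} (ht₀ : 0 < t₀)
    (hlip : IsLipschitzNear F u (t₀, x₀) ∨ IsLipschitzNear F v (t₀, x₀))
    {θ : ℝ → ℝ} (hθ : ContDiff ℝ 1 θ) {ε : ℝ} (hε : 0 < ε)
    (hmin : ∀ᶠ z : ℝ × M in 𝓝 (t₀, x₀), v (t₀, x₀) - u (t₀, x₀) + θ t₀ ≤
      v z - u z + θ z.1 + ε * (|z.1 - t₀| + F.dist z.2 x₀)) :
    ∃ L : ℝ, 0 ≤ L ∧ ∀ ρ : ℝ, 0 < ρ → ∃ (t₁ t₂ : ℝ) (x₁ x₂ : M), 0 < t₁ ∧ 0 < t₂ ∧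
      |t₁ - t₂| ≤ 2 * ρ ∧ F.dist x₁ x₂ ≤ ρ ∧
      ∃ Λ₁ ∈ subdifferential (𝓘(ℝ, ℝ).prod 𝓘(ℝ, X)) (Ioi 0 ×ˢ univ) v (t₁, x₁),
      ∃ Λ₂ ∈ superdifferential (𝓘(ℝ, ℝ).prod 𝓘(ℝ, X)) (Ioi 0 ×ˢ univ) u (t₂, x₂),
        |timePart Λ₁ + deriv θ t₁ - timePart Λ₂| ≤ 3 * ε ∧
        |F.dualNorm x₁ (spacePart Λ₁) - F.dualNorm x₂ (spacePart Λ₂)| ≤ 6 * ε ∧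
        F.dualNorm x₁ (spacePart Λ₁) ≤ L ∧ F.dualNorm x₂ (spacePart Λ₂) ≤ L := by
  obtain ⟨L₀, hL₀, U, hU, hlipU⟩ : ∃ L₀ : ℝ, 0 ≤ L₀ ∧ ∃ U ∈ 𝓝 ((t₀, x₀) : ℝ × M),
      (∀ q ∈ U, ∀ r ∈ U, |u q - u r| ≤ L₀ * (|q.1 - r.1| + F.dist q.2 r.2)) ∨
      (∀ q ∈ U, ∀ r ∈ U, |v q - v r| ≤ L₀ * (|q.1 - r.1| + F.dist q.2 r.2)) := by
    rcases hlip with ⟨L, hL, U, hU, h⟩ | ⟨L, hL, U, hU, h⟩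
    · exact ⟨L, hL, U, hU, Or.inl h⟩
    · exact ⟨L, hL, U, hU, Or.inr h⟩
  -- A bound for both covectors in the norm `Q`: the Lipschitz function gives `L₀ * (1 + τ)`, and
  -- the other covector differs by at most `σ ≤ 19 / 8 * ε`. It is fixed before `ρ`.
  set ℓ := 2 * L₀ + 5 * ε with hℓ
  have hℓ0 : 0 < ℓ := by positivity
  refine ⟨2 * ℓ, by positivity, fun ρ hρ => ?_⟩
  set e := chartAt X x₀ with he
  have hx₀ : x₀ ∈ e.source := mem_chart_source X x₀
  obtain ⟨K, hK1, hK⟩ := F.exists_chartNorm_equiv x₀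
  set Q : X → ℝ := chartNorm F.normAt e x₀ with hQdef
  have hQ0 : ∀ v, 0 ≤ Q v := chartNorm_nonneg _ _ _
  set τ := min (1 / 8) (ε / (8 * (ℓ + 1))) with hτdef
  have hτ : 0 < τ := by positivity
  have hτ8 : τ ≤ 1 / 8 := min_le_left _ _
  have hτℓ : 8 * τ * ℓ ≤ ε := by
    have h1 : τ ≤ ε / (8 * (ℓ + 1)) := min_le_right _ _
    rw [le_div_iff₀ (by positivity)] at h1
    nlinarith
  obtain ⟨r₁, c, hr₁, hc, hball⟩ := F.exists_ball_dist_le x₀ hτ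
  obtain ⟨Kθ, V, hV, hθV⟩ := hθ.contDiffAt.exists_lipschitzOnWith (x := t₀)
  let Ψ : ℝ × X → ℝ × M := fun w => (w.1, e.symm w.2)
  set y₀ : ℝ × X := (t₀, e x₀) with hy₀
  have hΨ₀ : Ψ y₀ = (t₀, x₀) := by simp [Ψ, hy₀, e.left_inv hx₀]
  have hΨc : ContinuousOn Ψ (univ ×ˢ e.target) :=
    continuousOn_fst.prodMk (e.continuousOn_symm.comp continuousOn_snd fun w hw => hw.2)
  have hΨt : Tendsto Ψ (𝓝 y₀) (𝓝 (t₀, x₀)) := by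
    rw [← hΨ₀]
    exact hΨc.continuousAt (prod_mem_nhds univ_mem (e.open_target.mem_nhds (e.map_source hx₀)))
  have hIci : ∀ᶠ z : ℝ × M in 𝓝 (t₀, x₀), 0 < z.1 :=
    continuous_fst.continuousAt.eventually (lt_mem_nhds ht₀)
  have hnhds : 𝓝[Ici (0 : ℝ) ×ˢ (univ : Set M)] (t₀, x₀) = 𝓝 (t₀, x₀) :=
    nhdsWithin_eq_nhds.2 (prod_mem_nhds (Ici_mem_nhds ht₀) univ_mem)
  have hvb : ∀ᶠ z in 𝓝 ((t₀, x₀) : ℝ × M), v (t₀, x₀) - 1 < v z := by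
    have := hv (t₀, x₀) ⟨ht₀.le, mem_univ _⟩ (v (t₀, x₀) - 1) (by linarith)
    rwa [hnhds] at this
  have hub : ∀ᶠ z in 𝓝 ((t₀, x₀) : ℝ × M), u z < u (t₀, x₀) + 1 := by
    have := hu (t₀, x₀) ⟨ht₀.le, mem_univ _⟩ (u (t₀, x₀) + 1) (by linarith)
    rwa [hnhds] at this
  have hθb : ∀ᶠ z in 𝓝 ((t₀, x₀) : ℝ × M), θ t₀ - 1 < θ z.1 := by
    have : Continuous fun z : ℝ × M => θ z.1 := hθ.continuous.comp continuous_fst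
    exact this.continuousAt.eventually (lt_mem_nhds (by simp))
  have hVb : ∀ᶠ z in 𝓝 ((t₀, x₀) : ℝ × M), z.1 ∈ V := continuous_fst.continuousAt.eventually hV
  have hr₁b : ∀ᶠ w in 𝓝 y₀, w.2 ∈ Metric.ball (e x₀) r₁ :=
    continuous_snd.continuousAt.eventually (Metric.ball_mem_nhds _ hr₁)
  obtain ⟨r, hr, hS⟩ := Metric.nhds_basis_closedBall.eventually_iff.1
    (hr₁b.and (hΨt.eventually (hIci.and (hmin.and (hvb.and (hub.and (hθb.and
      (hVb.and hU))))))))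
  simp only [Ψ] at hS
  have hdist : ∀ w ∈ Metric.closedBall y₀ r, ∀ w' ∈ Metric.closedBall y₀ r,
      F.dist (e.symm w.2) (e.symm w'.2) ≤ (1 + τ) * Q (w.2 - w'.2) := fun w hw w' hw' =>
    (hball _ (hS hw).1).2.2.2 _ (hS hw').1
  have hQK : ∀ w w' : ℝ × X, (1 + τ) * Q (w.2 - w'.2) ≤ 2 * K * ‖w - w'‖ := by
    intro w w'
    have h1 := (hK (w.2 - w'.2)).2
    have h2 : ‖w.2 - w'.2‖ ≤ ‖w - w'‖ := norm_snd_le (w - w')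
    have h3 : K * ‖w.2 - w'.2‖ ≤ K * ‖w - w'‖ := by gcongr
    have h4 : (1 + τ) * Q (w.2 - w'.2) ≤ 2 * Q (w.2 - w'.2) :=
      mul_le_mul_of_nonneg_right (by linarith) (hQ0 _)
    linarith
  have hdK : ∀ w ∈ Metric.closedBall y₀ r, ∀ w' ∈ Metric.closedBall y₀ r,
      |w.1 - w'.1| + F.dist (e.symm w.2) (e.symm w'.2) ≤ (1 + 2 * K) * ‖w - w'‖ := by
    intro w hw w' hw'
    have h1 := hdist w hw w' hw'
    have h2 : |w.1 - w'.1| ≤ ‖w - w'‖ := norm_fst_le (w - w')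
    linarith [hQK w w']
  let f₁ : ℝ × X → ℝ := fun w => v (w.1, e.symm w.2) + θ w.1
  let f₂ : ℝ × X → ℝ := fun w => -u (w.1, e.symm w.2)
  -- Minimality needs only the coefficient `ε`; the second `ε` makes the minimum strong, as the sum
  -- rule requires.
  let f₃ : ℝ × X → ℝ := fun w => 2 * ε * (|w.1 - t₀| + F.dist (e.symm w.2) x₀)
  set L := L₀ * (1 + 2 * K) + Kθ + 2 * ε * (1 + 2 * K) with hLdef
  have hL0 : 0 ≤ L := by positivity
  have hf₃d : ∀ w ∈ Metric.closedBall y₀ r, ∀ w' ∈ Metric.closedBall y₀ r,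
      f₃ w - f₃ w' ≤ 2 * ε * (|w.1 - w'.1| + (1 + τ) * Q (w.2 - w'.2)) := by
    intro w hw w' hw'
    have h1 := F.dist_triangle (e.symm w.2) (e.symm w'.2) x₀
    have h2 := abs_sub_le w.1 w'.1 t₀
    have h3 := hdist w hw w' hw'
    simp only [f₃]
    rw [← mul_sub]
    gcongr
    linarith
  have hL₃ : ∀ w ∈ Metric.closedBall y₀ r, ∀ w' ∈ Metric.closedBall y₀ r,
      f₃ w - f₃ w' ≤ L * ‖w - w'‖ := by
    intro w hw w' hw'
    refine (hf₃d w hw w' hw').trans ?_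
    have h2 : |w.1 - w'.1| ≤ ‖w - w'‖ := norm_fst_le (w - w')
    calc 2 * ε * (|w.1 - w'.1| + (1 + τ) * Q (w.2 - w'.2))
        ≤ 2 * ε * ((1 + 2 * K) * ‖w - w'‖) := by gcongr; linarith [hQK w w']
      _ ≤ L * ‖w - w'‖ := by
        rw [← mul_assoc, hLdef]
        gcongr
        have : 0 ≤ L₀ * (1 + 2 * K) + (Kθ : ℝ) := by positivity
        linarith
  have hmaps : MapsTo Ψ (Metric.closedBall y₀ r) (Ici 0 ×ˢ univ) := fun w hw =>
    ⟨(hS hw).2.1.le, mem_univ _⟩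
  have hΨS : ContinuousOn Ψ (Metric.closedBall y₀ r) :=
    hΨc.mono fun w hw => ⟨mem_univ _, (hball _ (hS hw).1).1⟩
  have hf₁l : LowerSemicontinuousOn f₁ (Metric.closedBall y₀ r) :=
    (hv.comp hΨS hmaps).add (hθ.continuous.comp continuous_fst).continuousOn.lowerSemicontinuousOn
  have hf₂l : LowerSemicontinuousOn f₂ (Metric.closedBall y₀ r) := by
    intro w hw y hy
    have h1 := (hu.comp hΨS hmaps) w hw (-y) (by
      simp only [f₂] at hy
      simp only [Function.comp_apply, Ψ]
      linarith)
    filter_upwards [h1] with w' hw'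
    simp only [Function.comp_apply, Ψ] at hw'
    simp only [f₂]
    linarith
  have hf₃l : LowerSemicontinuousOn f₃ (Metric.closedBall y₀ r) := by
    have : LipschitzOnWith (Real.toNNReal L) f₃ (Metric.closedBall y₀ r) :=
      LipschitzOnWith.of_dist_le_mul fun w hw w' hw' => by
        rw [Real.coe_toNNReal _ hL0, Real.dist_eq, dist_eq_norm, abs_le]
        have := hL₃ w' hw' w hw
        rw [norm_sub_rev] at this
        exact ⟨by linarith, hL₃ w hw w' hw'⟩
    exact this.continuousOn.lowerSemicontinuousOn
  have hL₁₂ : (∀ z ∈ Metric.closedBall y₀ r, ∀ w ∈ Metric.closedBall y₀ r,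
        f₁ z - f₁ w ≤ L * ‖z - w‖) ∨
      ∀ z ∈ Metric.closedBall y₀ r, ∀ w ∈ Metric.closedBall y₀ r, f₂ z - f₂ w ≤ L * ‖z - w‖ := by
    have hbig : ∀ z w : ℝ × X, L₀ * ((1 + 2 * K) * ‖z - w‖) + Kθ * ‖z - w‖ ≤ L * ‖z - w‖ := by
      intro z w
      have : 0 ≤ 2 * ε * (1 + 2 * K) * ‖z - w‖ := by positivity
      rw [hLdef]
      linarith
    rcases hlipU with h | h
    · right
      intro z hz w hw
      have h1 := (abs_le.1 (h _ (hS hz).2.2.2.2.2.2.2 _ (hS hw).2.2.2.2.2.2.2)).1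
      have h2 := mul_le_mul_of_nonneg_left (hdK z hz w hw) hL₀
      have h3 : 0 ≤ (Kθ : ℝ) * ‖z - w‖ := by positivity
      simp only [f₂]
      linarith [hbig z w]
    · left
      intro z hz w hw
      have h1 := (abs_le.1 (h _ (hS hz).2.2.2.2.2.2.2 _ (hS hw).2.2.2.2.2.2.2)).2
      have h2 := mul_le_mul_of_nonneg_left (hdK z hz w hw) hL₀
      have h3 := hθV.dist_le_mul _ (hS hz).2.2.2.2.2.2.1 _ (hS hw).2.2.2.2.2.2.1
      rw [Real.dist_eq, Real.dist_eq] at h3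
      have h4 : (Kθ : ℝ) * |z.1 - w.1| ≤ Kθ * ‖z - w‖ := by
        gcongr
        exact norm_fst_le (z - w)
      simp only [f₁]
      linarith [hbig z w, le_abs_self (θ z.1 - θ w.1)]
  have hexx : e.symm (e x₀) = x₀ := e.left_inv hx₀
  have hmin' : ∀ z ∈ Metric.closedBall y₀ r,
      f₁ y₀ + f₂ y₀ + f₃ y₀ + ε * min 1 c * ‖z - y₀‖ ≤ f₁ z + f₂ z + f₃ z := by
    intro z hz
    have h1 := (hS hz).2.2.1
    have h2 := (hball _ (hS hz).1).2.2.1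
    have h3 : min 1 c * ‖z - y₀‖ ≤ |z.1 - t₀| + F.dist (e.symm z.2) x₀ := by
      have h4 : ‖z - y₀‖ = max |z.1 - t₀| ‖z.2 - e x₀‖ := rfl
      rw [h4]
      rcases max_choice |z.1 - t₀| ‖z.2 - e x₀‖ with h5 | h5 <;> rw [h5]
      · have := mul_le_mul_of_nonneg_right (min_le_left 1 c) (abs_nonneg (z.1 - t₀))
        linarith [F.dist_nonneg (e.symm z.2) x₀]
      · have := mul_le_mul_of_nonneg_right (min_le_right 1 c) (norm_nonneg (z.2 - e x₀))
        linarith [abs_nonneg (z.1 - t₀)]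
    have h6 : f₁ y₀ + f₂ y₀ + f₃ y₀ = v (t₀, x₀) - u (t₀, x₀) + θ t₀ := by
      simp only [f₁, f₂, f₃, hy₀, hexx, F.dist_self, sub_self, abs_zero]
      ring
    have h7 := mul_le_mul_of_nonneg_left h3 hε.le
    rw [h6, mul_assoc]
    simp only [f₁, f₂, f₃]
    linarith
  -- The bound `ρ / (4 * K)` controls the Finsler distance of the two points, and `ε / (8 * K)` the
  -- error of the sum rule measured in `Q`.
  set ρ' := min (min ρ (ρ / (4 * K))) (min (ε / (8 * K)) r) with hρ'def
  have hρ' : 0 < ρ' := by positivity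
  have hρ'ρ : ρ' ≤ ρ := (min_le_left _ _).trans (min_le_left _ _)
  have hρ'K : 4 * K * ρ' ≤ ρ := by
    have : ρ' ≤ ρ / (4 * K) := (min_le_left _ _).trans (min_le_right _ _)
    rwa [le_div_iff₀' (by positivity)] at this
  have hρ'ε : 8 * K * ρ' ≤ ε := by
    have : ρ' ≤ ε / (8 * K) := (min_le_right _ _).trans (min_le_left _ _)
    rwa [le_div_iff₀' (by positivity)] at this
  have hρ'r : ρ' ≤ r := (min_le_right _ _).trans (min_le_right _ _)
  obtain ⟨z₁, z₂, z₃, g₁, g₂, g₃, hz₁, hz₂, hz₃, hg₁, hg₂, hg₃, m₁, m₂, m₃, hsum⟩ :=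
    (hasNormalizedBump_real.prod hX).exists_isLocalMin_add hr hf₁l hf₂l hf₃l
      (B := min (v (t₀, x₀) + θ t₀ - 2) (min (-u (t₀, x₀) - 1) 0))
      (fun z hz => by
        obtain ⟨-, -, -, h1, h2, h3, -⟩ := hS hz
        refine ⟨(min_le_left _ _).trans ?_,
          (min_le_right _ _).trans ((min_le_left _ _).trans ?_),
          (min_le_right _ _).trans ((min_le_right _ _).trans ?_)⟩
        · simp only [f₁]; linarith
        · simp only [f₂]; linarith
        · have := F.dist_nonneg (e.symm z.2) x₀
          simp only [f₃]; positivity)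
      hL0 hL₁₂ hL₃ (show 0 < ε * min 1 c by positivity) hmin' hρ'
  have hmem : ∀ z, ‖z - y₀‖ < ρ' → Metric.closedBall y₀ r ∈ 𝓝 z := fun z hz =>
    mem_of_superset (Metric.isOpen_ball.mem_nhds (mem_ball_iff_norm.2 (hz.trans_le hρ'r)))
      Metric.ball_subset_closedBall
  have hS₁ := mem_of_mem_nhds (hmem z₁ hz₁)
  have hS₂ := mem_of_mem_nhds (hmem z₂ hz₂)
  have hS₃ := mem_of_mem_nhds (hmem z₃ hz₃)
  obtain ⟨ht₁, hn₁, -⟩ := hball _ (hS hS₁).1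
  obtain ⟨ht₂, hn₂, -⟩ := hball _ (hS hS₂).1
  -- Being `C¹`, `θ` is absorbed into the test function for `v`; it affects only the time part.
  let gθ : ℝ × X → ℝ := fun w => θ w.1 + g₁ w
  have hgθ : ContDiff ℝ 1 gθ := (hθ.comp contDiff_fst).add hg₁
  have m₁' : IsLocalMin (fun w : ℝ × X => v (w.1, e.symm w.2) + gθ w) z₁ := by
    simpa only [f₁, gθ, add_assoc] using m₁
  obtain ⟨Λ₁, hΛ₁, hΛ₁t, hΛ₁s⟩ := exists_mem_subdifferential hX x₀ ht₁ hgθ z₁.1 m₁'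
  obtain ⟨Λ₂, hΛ₂, hΛ₂t, hΛ₂s⟩ := exists_mem_superdifferential hX x₀ ht₂ hg₂ z₂.1 m₂
  have hgθd : ∀ (s : ℝ) (w : X),
      fderiv ℝ gθ z₁ (s, w) = deriv θ z₁.1 * s + fderiv ℝ g₁ z₁ (s, w) := by
    intro s w
    have h1 : HasFDerivAt (fun w : ℝ × X => θ w.1)
        ((deriv θ z₁.1) • ContinuousLinearMap.fst ℝ ℝ X) z₁ :=
      (hθ.differentiable one_ne_zero z₁.1).hasDerivAt.comp_hasFDerivAt z₁ hasFDerivAt_fst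
    have h2 := h1.add (hg₁.differentiable one_ne_zero z₁).hasFDerivAt
    have h3 : fderiv ℝ gθ z₁ = _ := h2.fderiv
    rw [h3]
    simp
  have hsumw : ∀ y : ℝ × X, |fderiv ℝ g₁ z₁ y + fderiv ℝ g₂ z₂ y + fderiv ℝ g₃ z₃ y| ≤ ρ' * ‖y‖ :=
    fun y => (ContinuousLinearMap.le_opNorm _ y).trans
      (mul_le_mul_of_nonneg_right hsum (norm_nonneg y))
  have hQs : ∀ (s : ℝ) w, (1 + τ) * Q (s • w) = |s| * ((1 + τ) * Q w) := fun s w => by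
    rw [hQdef, chartNorm_smul]; ring
  have hd₃ : ∀ (s : ℝ) (w : X), |fderiv ℝ g₃ z₃ (s, w)| ≤ 2 * ε * (|s| + (1 + τ) * Q w) :=
    abs_fderiv_le_of_isLocalMin_add_of_lipschitz (Q := fun w => (1 + τ) * Q w) hQs hg₃ m₃
      (by filter_upwards [hmem z₃ hz₃] with w hw using hf₃d w hw z₃ hS₃)
  set a : X → ℝ := fun w => -fderiv ℝ gθ z₁ (0, w) with ha
  set b : X → ℝ := fun w => fderiv ℝ g₂ z₂ (0, w) with hb
  set σ := 2 * ε * (1 + τ) + ρ' * K with hσ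
  have hσ0 : 0 ≤ σ := by positivity
  have hab : ∀ w, |a w - b w| ≤ σ * Q w := by
    intro w
    have h1 := hd₃ 0 w
    have h2 := hsumw (0, w)
    have h3 : ‖((0 : ℝ), w)‖ ≤ K * Q w := by simpa [Prod.norm_def] using (hK w).1
    have h4 := mul_le_mul_of_nonneg_left h3 hρ'.le
    rw [abs_zero, zero_add] at h1
    simp only [ha, hb, hgθd, mul_zero, zero_add]
    have h5 := abs_le.1 h1
    have h6 := abs_le.1 h2
    rw [hσ, abs_le]
    constructor <;> linarith
  have hLip : (∀ w, |b w| ≤ L₀ * ((1 + τ) * Q w)) ∨ ∀ w, |a w| ≤ L₀ * ((1 + τ) * Q w) := by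
    rcases hlipU with h | h
    · left
      intro w
      have := abs_fderiv_le_of_isLocalMin_add_of_lipschitz (Q := fun w => (1 + τ) * Q w)
        (ℓ := L₀) hQs hg₂ m₂ (by
          filter_upwards [hmem z₂ hz₂] with w hw
          refine (neg_le_of_abs_le (h _ (hS hw).2.2.2.2.2.2.2 _ (hS hS₂).2.2.2.2.2.2.2)
            |> fun h => show f₂ w - f₂ z₂ ≤ _ by simp only [f₂]; linarith).trans
            (mul_le_mul_of_nonneg_left (add_le_add le_rfl (hdist w hw z₂ hS₂)) hL₀)) 0 w
      simpa using this
    · right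
      intro w
      have := abs_fderiv_le_of_isLocalMin_add_of_lipschitz (Q := fun w => (1 + τ) * Q w)
        (ℓ := L₀) hQs hgθ m₁' (by
          filter_upwards [hmem z₁ hz₁] with w hw
          exact ((le_abs_self _).trans (h _ (hS hw).2.2.2.2.2.2.2 _ (hS hS₁).2.2.2.2.2.2.2)).trans
            (mul_le_mul_of_nonneg_left (add_le_add le_rfl (hdist w hw z₁ hS₁)) hL₀)) 0 w
      simpa [ha] using this
  have hσε : σ ≤ 19 / 8 * ε := by
    rw [hσ]
    nlinarith
  -- Only one of `u`, `v` is Lipschitz; closeness of the covectors passes its gradient bound to the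
  -- other.
  have hboth : (∀ w, |b w| ≤ ℓ * Q w) ∧ ∀ w, |a w| ≤ ℓ * Q w := by
    have key : ∀ w, L₀ * ((1 + τ) * Q w) + σ * Q w ≤ ℓ * Q w := fun w => by
      rw [← mul_assoc, ← add_mul]
      refine mul_le_mul_of_nonneg_right ?_ (hQ0 w)
      rw [hℓ]
      nlinarith
    have hσQ : ∀ w, 0 ≤ σ * Q w := fun w => mul_nonneg hσ0 (hQ0 w)
    rcases hLip with h | h
    · refine ⟨fun w => by linarith [h w, key w, hσQ w], fun w => ?_⟩
      have : |a w| ≤ |a w - b w| + |b w| := by simpa using abs_add_le (a w - b w) (b w)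
      linarith [h w, key w, hab w]
    · refine ⟨fun w => ?_, fun w => by linarith [h w, key w, hσQ w]⟩
      have : |b w| ≤ |a w - b w| + |a w| := by
        rw [abs_sub_comm]; simpa using abs_add_le (b w - a w) (a w)
      linarith [h w, key w, hab w]
  obtain ⟨e₂, e₁₂⟩ := F.dualNorm_le_dualNorm_add x₀ ht₁ ht₂ (Q := Q) (a := a) (b := b) hτ.le hσ0
    hℓ0.le (fun w => (hn₁ w).1) (fun w => (hn₂ w).1) (fun w => (hn₂ w).2) hΛ₁s hΛ₂s hab hboth.1
  obtain ⟨e₁, e₂₁⟩ := F.dualNorm_le_dualNorm_add x₀ ht₂ ht₁ (Q := Q) (a := b) (b := a) hτ.le hσ0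
    hℓ0.le (fun w => (hn₂ w).1) (fun w => (hn₁ w).1) (fun w => (hn₁ w).2) hΛ₂s hΛ₁s
    (fun w => by rw [abs_sub_comm]; exact hab w) hboth.2
  have hℓτ : ℓ * (1 + τ) ≤ 2 * ℓ := by linarith
  have harith : ∀ d d' : ℝ, 0 ≤ d → d ≤ ℓ * (1 + τ) → d' ≤ (d * (1 + τ) + σ) * (1 + τ) →
      d' - d ≤ 6 * ε := by
    intro d d' hd0 hd hd'
    have h1 : d ≤ 2 * ℓ := hd.trans hℓτ
    have h2 : d * τ ≤ 2 * ℓ * τ := by gcongr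
    have h3 : d * τ * τ ≤ d * τ := mul_le_of_le_one_right (by positivity) (by linarith)
    have h4 : σ * τ ≤ σ * (1 / 8) := by gcongr
    have h5 : (d * (1 + τ) + σ) * (1 + τ) = d + 2 * (d * τ) + d * τ * τ + σ + σ * τ := by ring
    linarith
  refine ⟨z₁.1, z₂.1, e.symm z₁.2, e.symm z₂.2, (hS hS₁).2.1, (hS hS₂).2.1, ?_, ?_, Λ₁, hΛ₁, Λ₂,
    hΛ₂, ?_, ?_, e₁.trans hℓτ, e₂.trans hℓτ⟩
  · have h1 : |z₁.1 - t₀| ≤ ‖z₁ - y₀‖ := norm_fst_le (z₁ - y₀)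
    have h2 : |z₂.1 - t₀| ≤ ‖z₂ - y₀‖ := norm_fst_le (z₂ - y₀)
    have h3 := abs_sub_le z₁.1 t₀ z₂.1
    rw [abs_sub_comm t₀] at h3
    linarith
  · refine (hdist _ hS₁ _ hS₂).trans ((hQK z₁ z₂).trans ?_)
    have h1 : ‖z₁ - z₂‖ ≤ 2 * ρ' := by
      have h2 := norm_sub_le (z₁ - y₀) (z₂ - y₀)
      rw [sub_sub_sub_cancel_right] at h2
      linarith
    have h2 : 2 * K * ‖z₁ - z₂‖ ≤ 2 * K * (2 * ρ') := by gcongr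
    linarith
  · rw [hΛ₁t, hΛ₂t]
    have h1 := hd₃ 1 0
    have h2 := hsumw (1, 0)
    have h3 : ‖((1 : ℝ), (0 : X))‖ = 1 := by simp [Prod.norm_def]
    have h4 : Q 0 = 0 := by simpa using chartNorm_smul F.normAt e x₀ 0 (0 : X)
    rw [h4] at h1
    rw [h3, mul_one] at h2
    have h5 : fderiv ℝ gθ (z₁.1, z₁.2) (1, 0) = _ := hgθd 1 0
    rw [h5]
    have h6 : ρ' ≤ ε := by nlinarith
    rw [abs_one, mul_zero, add_zero, mul_one] at h1
    have h7 := abs_le.1 h1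
    have h8 := abs_le.1 h2
    rw [abs_le]
    constructor <;> linarith
  · rw [abs_le]
    have h1 := harith _ _ (F.dualNorm_nonneg _ _) e₂ e₁₂
    have h2 := harith _ _ (F.dualNorm_nonneg _ _) e₁ e₂₁
    constructor <;> linarith

end Comparison

/-! ### Ekeland's principle on `[a, b] × M`. -/

section Ekeland

variable {X : Type*} [NormedAddCommGroup X] [NormedSpace ℝ X]
  {M : Type*} [TopologicalSpace M] [ChartedSpace X M] [IsManifold 𝓘(ℝ, X) 1 M]
  [RegularSpace M] [ConnectedSpace M]

/-- Ekeland's variational principle on `[a, b] × M`, for a complete Finsler manifold `M`. -/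
theorem FinslerStructure.exists_ekeland_point (F : FinslerStructure X M) (hF : F.IsComplete)
    {a b : ℝ} {w : ℝ × M → ℝ} (hw : LowerSemicontinuousOn w (Icc a b ×ˢ univ)) {B : ℝ}
    (hB : ∀ z ∈ Icc a b ×ˢ (univ : Set M), B ≤ w z) {z₁ : ℝ × M} (hz₁ : z₁.1 ∈ Icc a b)
    {ε : ℝ} (hε : 0 < ε) :
    ∃ z₀ : ℝ × M, z₀.1 ∈ Icc a b ∧ w z₀ ≤ w z₁ ∧
      ∀ z : ℝ × M, z.1 ∈ Icc a b → w z₀ ≤ w z + ε * (|z.1 - z₀.1| + F.dist z.2 z₀.2) := by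
  let d : {z : ℝ × M // z.1 ∈ Icc a b} → {z : ℝ × M // z.1 ∈ Icc a b} → ℝ :=
    fun z z' => |z.1.1 - z'.1.1| + F.dist z.1.2 z'.1.2
  have hcomplete : ∀ s : ℕ → {z : ℝ × M // z.1 ∈ Icc a b},
      (∀ δ : ℝ, 0 < δ → ∃ N, ∀ m ≥ N, ∀ n ≥ N, d (s m) (s n) < δ) →
      ∃ z, Tendsto (fun n => d (s n) z) atTop (𝓝 0) ∧
        ∀ c, (∀ᶠ n in atTop, w (s n).1 ≤ c) → w z.1 ≤ c := by
    intro s hs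
    have hs1 : CauchySeq fun n => (s n).1.1 := by
      refine Metric.cauchySeq_iff.2 fun δ hδ => ?_
      obtain ⟨N, hN⟩ := hs δ hδ
      refine ⟨N, fun m hm n hn => ?_⟩
      rw [Real.dist_eq]
      have h3 : |(s m).1.1 - (s n).1.1| + F.dist (s m).1.2 (s n).1.2 < δ := hN m hm n hn
      linarith [F.dist_nonneg (s m).1.2 (s n).1.2]
    obtain ⟨t, ht⟩ := cauchySeq_tendsto_of_complete hs1
    obtain ⟨x, hx⟩ := hF (fun n => (s n).1.2) fun δ hδ => by
      obtain ⟨N, hN⟩ := hs δ hδ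
      refine ⟨N, fun m hm n hn => ?_⟩
      have h3 : |(s m).1.1 - (s n).1.1| + F.dist (s m).1.2 (s n).1.2 < δ := hN m hm n hn
      linarith [abs_nonneg ((s m).1.1 - (s n).1.1)]
    have htI : t ∈ Icc a b := isClosed_Icc.mem_of_tendsto ht (Eventually.of_forall fun n => (s n).2)
    refine ⟨⟨(t, x), htI⟩, ?_, fun c hc => ?_⟩
    · have h1 : Tendsto (fun n => |(s n).1.1 - t|) atTop (𝓝 0) := by
        have := tendsto_iff_dist_tendsto_zero.1 ht
        simpa only [Real.dist_eq] using this
      simpa [d] using h1.add hx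
    · by_contra! hlt
      have h1 : Tendsto (fun n => (s n).1) atTop (𝓝[Icc a b ×ˢ univ] (t, x)) :=
        tendsto_nhdsWithin_iff.2 ⟨ht.prodMk_nhds (F.tendsto_of_tendsto_dist hx),
          Eventually.of_forall fun n => ⟨(s n).2, mem_univ _⟩⟩
      obtain ⟨n, hn1, hn2⟩ :=
        (hc.and (h1.eventually (hw (t, x) ⟨htI, mem_univ _⟩ c hlt))).exists
      linarith
  obtain ⟨⟨z₀, hz₀⟩, h1, h2⟩ := FinslerHJ.exists_ekeland_point
    (d := d)
    (fun z z' => add_nonneg (abs_nonneg _) (F.dist_nonneg _ _))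
    (fun z => by simp [d, F.dist_self])
    (fun z z' => by simp only [d]; rw [abs_sub_comm, F.dist_comm])
    (fun z z' z'' => by
      simp only [d]
      linarith [abs_sub_le z.1.1 z'.1.1 z''.1.1, F.dist_triangle z.1.2 z'.1.2 z''.1.2])
    (f := fun z => w z.1) (B := B) (fun z => hB _ ⟨z.2, mem_univ _⟩) hcomplete ⟨z₁, hz₁⟩ hε
  exact ⟨z₀, hz₀, h1, fun z hz => h2 ⟨z, hz⟩⟩

end Ekeland

end FinslerHJ

/-! ### The comparison theorem. -/

theorem mainTheorem4
    {X : Type*} [NormedAddCommGroup X] [NormedSpace ℝ X] [CompleteSpace X]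
    (hX : FinslerHJ.HasC1LipschitzBump X)
    {M : Type*} [TopologicalSpace M] [T2Space M] [ParacompactSpace M] [ConnectedSpace M]
    [ChartedSpace X M] [IsManifold 𝓘(ℝ, X) 1 M]
    (F : FinslerHJ.FinslerStructure X M) (hF : F.IsComplete)
    (H : ℝ → M → ℝ → ℝ)
    (hH : ContinuousOn (fun p : ℝ × M × ℝ => H p.1 p.2.1 p.2.2) (Ici 0 ×ˢ univ))
    (hA : FinslerHJ.ConditionA F H)
    (h : M → ℝ) (h_cont : Continuous h) (h_bdd : ∃ B : ℝ, ∀ x, |h x| ≤ B)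
    (u v : ℝ × M → ℝ)
    (hu : FinslerHJ.IsViscositySubsolution F H h u)
    (hv : FinslerHJ.IsViscositySupersolution F H h v)
    (h_uv_bdd : ∀ T : ℝ, 0 < T →
      ∃ B : ℝ, ∀ t : ℝ, 0 ≤ t → t < T → ∀ x : M, |u (t, x)| ≤ B ∧ |v (t, x)| ≤ B)
    (h_lip : ∀ (t : ℝ) (x : M), 0 < t →
      FinslerHJ.IsLipschitzNear F u (t, x) ∨ FinslerHJ.IsLipschitzNear F v (t, x)) :
    ∀ (t : ℝ) (x : M), 0 ≤ t → 0 ≤ v (t, x) - u (t, x) := by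
  intro t' x' ht'
  by_contra! hneg
  obtain ⟨hu_usc, hu_sub, hu0⟩ := hu
  obtain ⟨hv_lsc, hv_sup, hv0⟩ := hv
  set δ := -(v (t', x') - u (t', x')) with hδdef
  have hδ : 0 < δ := by linarith
  obtain ⟨B, hB⟩ := h_uv_bdd (t' + 2) (by linarith)
  have hB0 : 0 ≤ B := (abs_nonneg _).trans (hB t' ht' (by linarith) x').1
  -- Chosen so that `δ / 2 * κ = 2 * B + 1`; with `exp κ ≥ κ` this makes `v - u + θ ≥ 1` at time `t'
  -- + 1`.
  set κ := 2 * (2 * B + 1) / δ with hκdef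
  have hκ : 0 < κ := by positivity
  set θ : ℝ → ℝ := fun s => δ / 2 * Real.exp (κ * (s - t')) with hθdef
  have hθc : ContDiff ℝ 1 θ := by fun_prop
  have hθ0 : ∀ s, 0 < θ s := fun s => by positivity
  have hθt' : θ t' = δ / 2 := by simp [hθdef]
  have hθ1 : 2 * B + 1 ≤ θ (t' + 1) := by
    have h1 : κ ≤ Real.exp (κ * (t' + 1 - t')) := by
      have := Real.add_one_le_exp (κ * (t' + 1 - t'))
      have h2 : κ * (t' + 1 - t') = κ := by ring
      rw [h2] at this ⊢
      linarith
    have h2 : δ / 2 * κ = 2 * B + 1 := by rw [hκdef]; field_simp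
    rw [← h2]
    exact mul_le_mul_of_nonneg_left h1 (by positivity)
  -- This is `θ'(0)`, the least value of `θ'` on `[0, ∞)`.
  set m := κ * (δ / 2 * Real.exp (-(κ * t'))) with hmdef
  have hm : 0 < m := by positivity
  have hθd : ∀ s, 0 ≤ s → m ≤ deriv θ s := by
    intro s hs
    have h1 : HasDerivAt θ (δ / 2 * (Real.exp (κ * (s - t')) * (κ * 1))) s :=
      ((((hasDerivAt_id s).sub_const t').const_mul κ).exp).const_mul (δ / 2)
    rw [h1.deriv, hmdef]
    have h2 : Real.exp (-(κ * t')) ≤ Real.exp (κ * (s - t')) := by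
      refine Real.exp_le_exp.2 ?_
      nlinarith
    calc κ * (δ / 2 * Real.exp (-(κ * t'))) ≤ κ * (δ / 2 * Real.exp (κ * (s - t'))) := by gcongr
      _ = _ := by ring
  obtain ⟨C, ω, hC, hω, hω0, hCω⟩ := hA
  obtain ⟨η, hη, hηω⟩ : ∃ η > 0, ∀ a b c : ℝ, 0 ≤ a → a < η → |b| < η → |c| < η →
      ω (a, b, c) < m / 4 := by
    have h1 := hω (0, 0, 0) ⟨self_mem_Ici, mem_univ _⟩
    rw [ContinuousWithinAt, hω0] at h1
    obtain ⟨η, hη, h2⟩ := Metric.mem_nhdsWithin_iff.1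
      (h1.eventually_lt_const (show (0 : ℝ) < m / 4 by positivity))
    refine ⟨η, hη, fun a b c ha0 ha hb hc => h2 ⟨?_, ha0, mem_univ _⟩⟩
    rw [mem_ball_iff_norm]
    simp only [Prod.mk_sub_mk, sub_zero, Prod.norm_mk, Real.norm_eq_abs, sup_lt_iff]
    exact ⟨by rwa [abs_of_nonneg ha0], hb, hc⟩
  set ε := min (m / 16) (η / 12) with hεdef
  have hε : 0 < ε := by positivity
  have hεm : ε ≤ m / 16 := min_le_left _ _
  have hεη : ε ≤ η / 12 := min_le_right _ _
  have hsub : Icc 0 (t' + 1) ×ˢ (univ : Set M) ⊆ Ici 0 ×ˢ univ := fun z hz => ⟨hz.1.1, hz.2⟩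
  have hbd : ∀ z : ℝ × M, z.1 ∈ Icc 0 (t' + 1) → -(2 * B) ≤ v z - u z := by
    intro z hz
    obtain ⟨h1, h2⟩ := hB z.1 hz.1 (by linarith [hz.2]) z.2
    linarith [(abs_le.1 h1).2, (abs_le.1 h2).1]
  obtain ⟨⟨t₀, x₀⟩, ht₀, hw₀, hek⟩ := F.exists_ekeland_point hF
    (a := 0) (b := t' + 1) (w := fun z => v z + -u z + θ z.1) (B := -(2 * B))
    (by
      have h1 : LowerSemicontinuousOn (fun z => -u z) (Icc 0 (t' + 1) ×ˢ univ) := by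
        intro z hz y hy
        filter_upwards [(hu_usc.mono hsub) z hz (-y) (by linarith)] with z' hz'
        linarith
      exact ((hv_lsc.mono hsub).add h1).add
        (hθc.continuous.comp continuous_fst).continuousOn.lowerSemicontinuousOn)
    (fun z hz => by linarith [hbd z hz.1, hθ0 z.1])
    (z₁ := (t', x')) ⟨ht', by linarith⟩ hε
  simp only at ht₀ hw₀ hek
  rw [hθt'] at hw₀
  -- At both ends of the time interval `v - u + θ` is positive, whereas at the Ekeland point it is
  -- at most `-δ / 2`.
  have ht₀0 : 0 < t₀ := by
    rcases ht₀.1.eq_or_lt with h1 | h1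
    · subst h1
      linarith [hu0 x₀, hv0 x₀, hθ0 0]
    · exact h1
  have ht₀1 : t₀ < t' + 1 := by
    rcases ht₀.2.eq_or_lt with h1 | h1
    · subst h1
      linarith [hbd (t' + 1, x₀) ht₀]
    · exact h1
  obtain ⟨L, hL, hclose⟩ := FinslerHJ.exists_close_differentials hX.hasNormalizedBump F hu_usc hv_lsc
    ht₀0 (h_lip t₀ x₀ ht₀0) hθc hε (by
      have h1 : ∀ᶠ z : ℝ × M in 𝓝 (t₀, x₀), z.1 ∈ Icc 0 (t' + 1) :=
        continuous_fst.continuousAt.eventually (Icc_mem_nhds ht₀0 ht₀1)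
      filter_upwards [h1] with z hz
      linarith [hek z hz])
  -- `L` is already fixed, so the term `C * L * (3 * ρ)` of condition (A) can be made at most `m /
  -- 4`.
  set ρ := min (η / 4) (m / (12 * (C * L + 1))) with hρdef
  have hρ : 0 < ρ := by positivity
  have hρη : ρ ≤ η / 4 := min_le_left _ _
  have hρm : 12 * (C * L * ρ) ≤ m := by
    have h1 : ρ ≤ m / (12 * (C * L + 1)) := min_le_right _ _
    rw [le_div_iff₀ (by positivity)] at h1
    nlinarith
  obtain ⟨t₁, t₂, x₁, x₂, ht₁, ht₂, ht, hx, Λ₁, hΛ₁, Λ₂, hΛ₂, hα, hΔ, hL₁, hL₂⟩ := hclose ρ hρ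
  have h1 := hv_sup t₁ x₁ ht₁ Λ₁ hΛ₁
  have h2 := hu_sub t₂ x₂ ht₂ Λ₂ hΛ₂
  set r₁ := F.dualNorm x₁ (FinslerHJ.spacePart Λ₁)
  set r₂ := F.dualNorm x₂ (FinslerHJ.spacePart Λ₂)
  have h3 := (abs_le.1 (hCω t₁ t₂ ht₁.le ht₂.le x₁ x₂ r₁ r₂)).2
  have hd0 := F.dist_nonneg x₁ x₂
  have h4 := hηω |t₁ - t₂| (F.dist x₁ x₂) (r₁ - r₂) (abs_nonneg _) (by linarith)
    (by rw [abs_of_nonneg hd0]; linarith) (by linarith)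
  have h5 : max |r₁| |r₂| ≤ L := by
    rw [abs_of_nonneg (F.dualNorm_nonneg _ _), abs_of_nonneg (F.dualNorm_nonneg _ _)]
    exact max_le hL₁ hL₂
  have h6 : C * max |r₁| |r₂| * (|t₁ - t₂| + F.dist x₁ x₂) ≤ C * L * (3 * ρ) := by
    gcongr
    linarith
  have h7 := (abs_le.1 hα).2
  have h8 := hθd t₁ ht₁.le
  -- The inequalities add up to `0 ≤ 3 * ε - m + m / 4 + m / 4`, which contradicts `ε ≤ m / 16`.
  linarith
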